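/- Let $G$ be a compact connected simple Lie group with Lie algebra $\mathfrak g$, and let $\theta_1,\theta_2$ be commuting involutions of $G$ (smooth automorphisms with $\theta_i^2=1$ and $\theta_1\theta_2=\theta_2\theta_1$). Denote their differentials on $\mathfrak g$, and the $\mathbb C$-linear extensions of these to $\mathfrak g^{\mathbb C}$, by the same symbols, and let $\mathfrak k_i$ and $\mathfrak m_i$ be the $(+1)$- and $(-1)$-eigenspaces of $\theta_i$ in $\mathfrak g$. Let $\langle\cdot,\cdot\rangle$ be an invariant inner product on $\mathfrak g$. Let $\mathfrak t$ be a maximal abelian subalgebra of $\mathfrak g$ such that $\mathfrak t\cap\mathfrak m_i$ is maximal abelian in $\mathfrak m_i$ for $i=1,2$ and $\mathfrak a:=\mathfrak t\cap\mathfrak m_1\cap\mathfrak m_2$ is maximal abelian in $\mathfrak m_1\cap\mathfrak m_2$. Let $\mathrm{pr}$ be the orthogonal projection onto $\mathfrak a$, and put $\sigma_i=-\theta_i|_{\mathfrak t}$. For $\mathfrak s\in\{\mathfrak t,\mathfrak a\}$ and $\alpha\in\mathfrak s$ put $\mathfrak g(\mathfrak s,\alpha)=\{X\in\mathfrak g^{\mathbb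 C}\mid [H,X]=\sqrt{-1}\,\langle\alpha,H\rangle X\ \text{for all } H\in\mathfrak s\}$, and let $$\Delta=\{\alpha\in\mathfrak t\setminus\{0\}\mid \mathfrak g(\mathfrak t,\alpha)\ne 0\},\qquad \tilde\Sigma=\{\lambda\in\mathfrak a\setminus\{0\}\mid \mathfrak g(\mathfrak a,\lambda)\neq 0\}.$$ For $\lambda\in\mathfrak a$ and $\epsilon=\pm1$ let $\mathfrak g(\mathfrak a,\lambda,\epsilon)=\{X\in\mathfrak g(\mathfrak a,\lambda)\mid\theta_1\theta_2X=\epsilon X\}$. Put $$\Sigma=\{\lambda\in\tilde\Sigma\mid\mathfrak g(\mathfrak a,\lambda,1)\ne0\},\quad W=\{\lambda\in\tilde\Sigma\mid\mathfrak g(\mathfrak a,\lambda,-1)\ne0\},$$ $$m(\lambda)=\dim_{\mathbb C}\mathfrak g(\mathfrak a,\lambda,1),\quad n(\lambda)=\dim_{\mathbb C}\mathfrak g(\mathfrak a,\lambda,-1).$$ Let $\Delta_0=\{\alpha\in\Delta\mid\langle\alpha,\mathfrak a\rangle=\{0\}\}$. A root $\alpha\in\Delta\setminus\Delta_0$ is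 called complex if $\sigma_1\sigma_2(\alpha)\neq\alpha$, compact if $\mathfrak g(\mathfrak t,\alpha)\subset((\mathfrak k_1\cap\mathfrak k_2)\oplus(\mathfrak m_1\cap\mathfrak m_2))^{\mathbb C}$, and noncompact if $\mathfrak g(\mathfrak t,\alpha)\subset((\mathfrak k_1\cap\mathfrak m_2)\oplus(\mathfrak m_1\cap\mathfrak k_2))^{\mathbb C}$. Let $\Delta_{\mathrm{cpx}},\Delta_{\mathrm{cpt}},\Delta_{\mathrm{noncpt}}\subset\Delta\setminus\Delta_0$ be the sets of complex, compact and noncompact roots. Then $$\Sigma=\mathrm{pr}(\Delta_{\mathrm{cpt}})\cup\mathrm{pr}(\Delta_{\mathrm{cpx}}),\qquad W=\mathrm{pr}(\Delta_{\mathrm{noncpt}})\cup\mathrm{pr}(\Delta_{\mathrm{cpx}}),$$ and for every $\lambda\in\tilde\Sigma$ $$m(\lambda)=\#\{\alpha\in\Delta_{\mathrm{cpt}}\mid\mathrm{pr}(\alpha)=\lambda\}+\tfrac12\#\{\beta\in\Delta_{\mathrm{cpx}}\mid\mathrm{pr}(\beta)=\lambda\},$$ $$n(\lambda)=\#\{\alpha\in\Delta_{\mathrm{noncpt}}\mid\mathrm{pr}(\alpha)=\lambda\}+\tfrac12\#\{\beta\in\Delta_{\mathrm{cpx}}\mid\mathrm{pr}(\beta)=\lambda\}.$$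 -/

import Mathlib

open scoped TensorProduct Manifold ContDiff

namespace SymmTriad

noncomputable section

/-! ### The Lie algebra of a Lie group and the differential of an automorphism -/

section Group

variable {E : Type*} [NormedAddCommGroup E] [NormedSpace ℝ E]
  {G : Type*} [TopologicalSpace G] [ChartedSpace E G] [Group G]

/-- A smooth real Lie group has the smoothness for which Mathlib defines its Lie algebra. -/
instance instLieGroupMinSmoothness [LieGroup 𝓘(ℝ, E) ∞ G] :
    LieGroup 𝓘(ℝ, E) (minSmoothness ℝ 3) G :=
  LieGroup.of_le (n := ∞) (by
    simp only [minSmoothness_of_isRCLikeNormedField]; exact ENat.LEInfty.out)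

instance instFiniteDimensionalGroupLieAlgebra [FiniteDimensional ℝ E]
    [LieGroup 𝓘(ℝ, E) ∞ G] :
    FiniteDimensional ℝ (GroupLieAlgebra 𝓘(ℝ, E) G) :=
  inferInstanceAs (FiniteDimensional ℝ E)

variable (E) in
/-- An involution of the Lie group `G`: a smooth group automorphism `θ` with `θ² = 1`. -/
structure IsInvolution (θ : G ≃* G) : Prop where
  contMDiff : ContMDiff 𝓘(ℝ, E) 𝓘(ℝ, E) ∞ θ
  apply_apply : ∀ g, θ (θ g) = g

variable (E) in
/-- The differential of the automorphism `θ` at the identity element, as an endomorphism of the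
Lie algebra of `G`; note that `θ 1 = 1`. -/
def differential [LieGroup 𝓘(ℝ, E) ∞ G] (θ : G ≃* G) :
    GroupLieAlgebra 𝓘(ℝ, E) G →ₗ[ℝ] GroupLieAlgebra 𝓘(ℝ, E) G :=
  (mfderiv 𝓘(ℝ, E) 𝓘(ℝ, E) θ (1 : G)).toLinearMap

end Group

/-! ### Invariant inner products, maximal abelian subspaces, root spaces -/

section LieAlg

variable {L : Type*} [LieRing L] [LieAlgebra ℝ L]

variable (L) in
/-- An invariant inner product on the real Lie algebra `L`: a positive definite symmetric bilinear
form for which every `ad X` is skew-symmetric. On the Lie algebra of a connected Lie group `G` the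
last condition is equivalent to invariance under `Ad(G)`. -/
structure InvariantInnerProduct where
  form : LinearMap.BilinForm ℝ L
  symm : ∀ x y : L, form x y = form y x
  pos : ∀ x : L, x ≠ 0 → 0 < form x x
  invariant : ∀ x y z : L, form ⁅x, y⁆ z = - form y ⁅x, z⁆

theorem InvariantInnerProduct.isCompl [FiniteDimensional ℝ L] (B : InvariantInnerProduct L)
    (s : Submodule ℝ L) : IsCompl s (B.form.orthogonal s) := by
  have hr : B.form.IsRefl := fun x y h => by rw [B.symm]; exact h
  rw [LinearMap.BilinForm.isCompl_orthogonal_iff_disjoint hr, Submodule.disjoint_def]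
  intro x hx hx'
  by_contra h0
  exact (B.pos x h0).ne' (LinearMap.BilinForm.mem_orthogonal_iff.mp hx' x hx)

/-- The orthogonal projection of `L` onto `s`. -/
def InvariantInnerProduct.proj [FiniteDimensional ℝ L] (B : InvariantInnerProduct L)
    (s : Submodule ℝ L) : L →ₗ[ℝ] L :=
  s.projection (B.form.orthogonal s) (B.isCompl s)

/-- `𝔨`, the `(+1)`-eigenspace of `θ`. -/
def kSpace (θ : Module.End ℝ L) : Submodule ℝ L := θ.eigenspace 1

/-- `𝔪`, the `(-1)`-eigenspace of `θ`. -/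
def mSpace (θ : Module.End ℝ L) : Submodule ℝ L := θ.eigenspace (-1)

/-- `s` is a maximal abelian subspace of `V`. -/
def IsMaximalAbelian (V s : Submodule ℝ L) : Prop :=
  Maximal (fun u : Submodule ℝ L => u ≤ V ∧ ∀ x ∈ u, ∀ y ∈ u, ⁅x, y⁆ = 0) s

/-- `t` is a maximal abelian subalgebra of `L` adapted to `θ₁` and `θ₂`. -/
structure IsAdaptedTorus (θ₁ θ₂ : Module.End ℝ L) (t : Submodule ℝ L) : Prop where
  maximal : IsMaximalAbelian ⊤ t
  maximal_left : IsMaximalAbelian (mSpace θ₁) (t ⊓ mSpace θ₁)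
  maximal_right : IsMaximalAbelian (mSpace θ₂) (t ⊓ mSpace θ₂)
  maximal_inf : IsMaximalAbelian (mSpace θ₁ ⊓ mSpace θ₂) (t ⊓ (mSpace θ₁ ⊓ mSpace θ₂))

/-- The abelian subspace `𝔞 = 𝔱 ∩ (𝔪₁ ∩ 𝔪₂)`. -/
def aSpace (θ₁ θ₂ : Module.End ℝ L) (t : Submodule ℝ L) : Submodule ℝ L :=
  t ⊓ (mSpace θ₁ ⊓ mSpace θ₂)

/-- `𝔤(s, α) = {X ∈ 𝔤^ℂ | [H, X] = √-1 ⟨α, H⟩ X for all H ∈ s}`. -/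
def rootSpace (B : InvariantInnerProduct L) (s : Submodule ℝ L) (α : L) :
    Submodule ℂ (ℂ ⊗[ℝ] L) :=
  ⨅ H ∈ s, Module.End.eigenspace (LieAlgebra.ad ℂ (ℂ ⊗[ℝ] L) ((1 : ℂ) ⊗ₜ[ℝ] H))
    (Complex.I * (B.form α H : ℂ))

/-- The nonzero `α ∈ s` with `𝔤(s, α) ≠ 0`. For `s = 𝔱` this is the root system `Δ` of `𝔤`, for
`s = 𝔞` it is the set `Σ̃`. -/
def roots (B : InvariantInnerProduct L) (s : Submodule ℝ L) : Set L :=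
  {α | α ∈ s ∧ α ≠ 0 ∧ rootSpace B s α ≠ ⊥}

/-- `𝔤(𝔞, α, ε) = {X ∈ 𝔤(𝔞, α) | θ₁ θ₂ X = ε X}`. -/
def signedRootSpace (B : InvariantInnerProduct L) (θ₁ θ₂ : Module.End ℝ L)
    (a : Submodule ℝ L) (α : L) (ε : ℂ) : Submodule ℂ (ℂ ⊗[ℝ] L) :=
  rootSpace B a α ⊓ Module.End.eigenspace ((θ₁ * θ₂).baseChange ℂ) ε

/-- `Σ`. -/
def sigmaSet (B : InvariantInnerProduct L) (θ₁ θ₂ : Module.End ℝ L) (a : Submodule ℝ L) :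
    Set L :=
  {α | α ∈ roots B a ∧ signedRootSpace B θ₁ θ₂ a α 1 ≠ ⊥}

/-- `W`. -/
def wSet (B : InvariantInnerProduct L) (θ₁ θ₂ : Module.End ℝ L) (a : Submodule ℝ L) :
    Set L :=
  {α | α ∈ roots B a ∧ signedRootSpace B θ₁ θ₂ a α (-1) ≠ ⊥}

/-- The multiplicity `m(α)`. -/
def mMult (B : InvariantInnerProduct L) (θ₁ θ₂ : Module.End ℝ L) (a : Submodule ℝ L)
    (α : L) : ℕ :=
  Module.finrank ℂ (signedRootSpace B θ₁ θ₂ a α 1)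

/-- The multiplicity `n(α)`. -/
def nMult (B : InvariantInnerProduct L) (θ₁ θ₂ : Module.End ℝ L) (a : Submodule ℝ L)
    (α : L) : ℕ :=
  Module.finrank ℂ (signedRootSpace B θ₁ θ₂ a α (-1))

/-! ### Complex, compact and noncompact roots -/

/-- `Δ₀`, the roots orthogonal to `𝔞`. -/
def rootsZero (B : InvariantInnerProduct L) (θ₁ θ₂ : Module.End ℝ L) (t : Submodule ℝ L) :
    Set L :=
  {α | α ∈ roots B t ∧ ∀ H ∈ aSpace θ₁ θ₂ t, B.form α H = 0}

/-- `σ = -θ`, to be evaluated on the `θ`-invariant subspace `𝔱`. -/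
def sigmaMap (θ : Module.End ℝ L) : Module.End ℝ L := -θ

/-- The complex roots. -/
def rootsCpx (B : InvariantInnerProduct L) (θ₁ θ₂ : Module.End ℝ L) (t : Submodule ℝ L) :
    Set L :=
  {α | α ∈ roots B t \ rootsZero B θ₁ θ₂ t ∧ sigmaMap θ₁ (sigmaMap θ₂ α) ≠ α}

/-- The compact roots: `𝔤(𝔱, α) ⊆ ((𝔨₁ ∩ 𝔨₂) ⊕ (𝔪₁ ∩ 𝔪₂))^ℂ`. -/
def rootsCpt (B : InvariantInnerProduct L) (θ₁ θ₂ : Module.End ℝ L) (t : Submodule ℝ L) :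
    Set L :=
  {α | α ∈ roots B t \ rootsZero B θ₁ θ₂ t ∧
    rootSpace B t α ≤
      ((kSpace θ₁ ⊓ kSpace θ₂) ⊔ (mSpace θ₁ ⊓ mSpace θ₂)).baseChange ℂ}

/-- The noncompact roots: `𝔤(𝔱, α) ⊆ ((𝔨₁ ∩ 𝔪₂) ⊕ (𝔪₁ ∩ 𝔨₂))^ℂ`. -/
def rootsNoncpt (B : InvariantInnerProduct L) (θ₁ θ₂ : Module.End ℝ L) (t : Submodule ℝ L) :
    Set L :=
  {α | α ∈ roots B t \ rootsZero B θ₁ θ₂ t ∧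
    rootSpace B t α ≤
      ((kSpace θ₁ ⊓ mSpace θ₂) ⊔ (mSpace θ₁ ⊓ kSpace θ₂)).baseChange ℂ}

end LieAlg

end

end SymmTriad

/-! Let σ = θ₁θ₂ on 𝔤. It is an involutive automorphism that fixes 𝔞 pointwise and, since 𝔱 is
adapted, preserves 𝔱. The operators ad H with H ∈ 𝔱 are commuting and skew-Hermitian on 𝔤^ℂ, so 𝔤(𝔞,
λ) is the orthogonal sum of the spaces 𝔤(𝔱, α) with pr α = λ (`rootSpace_eq_iSup`). For λ ≠ 0 each
nonzero summand is a line, because 𝔱 is maximal abelian (`rootSpace_eq_span_singleton`).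

Simplicity of 𝔤 makes σ an isometry (`form_map_map`), so σ maps 𝔤(𝔱, α) onto 𝔤(𝔱, σα) and pr(σα) =
pr(α): it permutes the lines over λ. On a line with σα = α it acts by a sign, and
`eigenspace_mul_eq_sup` shows that the sign is +1 for compact and -1 for noncompact roots. The
complex roots fall into pairs {β, σβ}; on the plane of a pair σ has each of the eigenvalues ±1 once,
whence the factor 1/2. The count is a trace computation (`two_mul_finrank_eigenspace`). Finally Σ
and W are read off from the multiplicities, which vanish exactly when both of their terms do. -/

namespace SymmTriad

/-! ### Differentials of involutions are commuting involutive Lie algebra automorphisms. -/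

section Group

open VectorField

variable {E : Type*} [NormedAddCommGroup E] [NormedSpace ℝ E]
  {G : Type*} [TopologicalSpace G] [ChartedSpace E G] [Group G]

theorem IsInvolution.mdifferentiableAt {Θ : G ≃* G} (h : IsInvolution E Θ) (g : G) :
    MDifferentiableAt 𝓘(ℝ, E) 𝓘(ℝ, E) Θ g :=
  h.contMDiff.contMDiffAt.mdifferentiableAt (by simp)

theorem IsInvolution.mfderiv_mfderiv {Θ : G ≃* G} (h : IsInvolution E Θ) {g g' : G}
    (hg : Θ g = g') (v : TangentSpace 𝓘(ℝ, E) g) :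
    mfderiv 𝓘(ℝ, E) 𝓘(ℝ, E) Θ g' (mfderiv 𝓘(ℝ, E) 𝓘(ℝ, E) Θ g v) = v := by
  subst hg
  have h1 := mfderiv_comp (I := 𝓘(ℝ, E)) (I' := 𝓘(ℝ, E)) (I'' := 𝓘(ℝ, E)) g
    (h.mdifferentiableAt (Θ g)) (h.mdifferentiableAt g)
  have h2 : (Θ ∘ Θ : G → G) = id := funext h.apply_apply
  rw [h2, mfderiv_id] at h1
  exact (DFunLike.congr_fun h1 v).symm

variable [LieGroup 𝓘(ℝ, E) ∞ G]

theorem differential_mul_self {Θ : G ≃* G} (h : IsInvolution E Θ) :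
    differential E Θ * differential E Θ = 1 :=
  LinearMap.ext fun v => h.mfderiv_mfderiv (map_one Θ) v

theorem differential_commute {Θ₁ Θ₂ : G ≃* G} (h₁ : IsInvolution E Θ₁) (h₂ : IsInvolution E Θ₂)
    (hcomm : ∀ g, Θ₁ (Θ₂ g) = Θ₂ (Θ₁ g)) :
    differential E Θ₁ * differential E Θ₂ = differential E Θ₂ * differential E Θ₁ := by
  have key : ∀ {Φ Ψ : G ≃* G}, IsInvolution E Φ → IsInvolution E Ψ → ∀ v : E,
      (mfderiv 𝓘(ℝ, E) 𝓘(ℝ, E) (Φ ∘ Ψ) (1 : G) : E → E) v =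
      differential E Φ (differential E Ψ v) := by
    intro Φ Ψ hΦ hΨ v
    have := mfderiv_comp (I := 𝓘(ℝ, E)) (I' := 𝓘(ℝ, E)) (I'' := 𝓘(ℝ, E)) (1 : G)
      (hΦ.mdifferentiableAt (Ψ 1)) (hΨ.mdifferentiableAt 1)
    have h3 := DFunLike.congr_fun this v
    -- All tangent spaces are the model space `E`; viewing derivatives as functions `E → E` lets the
    -- base point be rewritten without a type mismatch.
    have h4 : (mfderiv 𝓘(ℝ, E) 𝓘(ℝ, E) Φ (Ψ 1) : E → E) = mfderiv 𝓘(ℝ, E) 𝓘(ℝ, E) Φ (1 : G) := by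
      rw [map_one]
    exact h3.trans (congrFun h4 _)
  refine LinearMap.ext fun v => ?_
  have h5 : (Θ₁ ∘ Θ₂ : G → G) = Θ₂ ∘ Θ₁ := funext hcomm
  have h6 := key h₁ h₂ v
  rw [h5] at h6
  exact h6.symm.trans (key h₂ h₁ v)

/-- Differentiate Θ ∘ L_g = L_{Θ g} ∘ Θ at the identity: Θ carries the left-invariant field of v to
that of dΘ v. As Θ is its own inverse, the inverse derivative in the pullback is again a derivative
of Θ. -/
theorem IsInvolution.mpullback_mulInvariantVectorField {Θ : G ≃* G} (h : IsInvolution E Θ)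
    (v : GroupLieAlgebra 𝓘(ℝ, E) G) :
    mpullback 𝓘(ℝ, E) 𝓘(ℝ, E) Θ (mulInvariantVectorField (differential E Θ v)) =
      mulInvariantVectorField v := by
  have hmul : ∀ g x : G, MDifferentiableAt 𝓘(ℝ, E) 𝓘(ℝ, E) (fun y : G => g * y) x := fun g x =>
    (contMDiff_mul_left (I := 𝓘(ℝ, E)) (n := ∞)).contMDiffAt.mdifferentiableAt (by simp)
  funext g
  have hinv : (mfderiv 𝓘(ℝ, E) 𝓘(ℝ, E) Θ g).inverse = mfderiv 𝓘(ℝ, E) 𝓘(ℝ, E) Θ (Θ g) :=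
    ContinuousLinearMap.inverse_eq
      (ContinuousLinearMap.ext fun v => h.mfderiv_mfderiv (h.apply_apply g) v)
      (ContinuousLinearMap.ext fun v => h.mfderiv_mfderiv rfl v)
  have hcomp : (fun y => Θ g * y) ∘ Θ = Θ ∘ (fun y => g * y) := by
    funext y; simp
  have e1 := mfderiv_comp (I := 𝓘(ℝ, E)) (I' := 𝓘(ℝ, E)) (I'' := 𝓘(ℝ, E)) (1 : G)
    (hmul (Θ g) (Θ 1)) (h.mdifferentiableAt 1)
  have e2 := mfderiv_comp (I := 𝓘(ℝ, E)) (I' := 𝓘(ℝ, E)) (I'' := 𝓘(ℝ, E)) (1 : G)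
    (h.mdifferentiableAt (g * 1)) (hmul g 1)
  rw [hcomp, e2] at e1
  have e3 : (mfderiv 𝓘(ℝ, E) 𝓘(ℝ, E) Θ (g * 1) : E → E) = mfderiv 𝓘(ℝ, E) 𝓘(ℝ, E) Θ g := by
    rw [mul_one]
  have e4 : (mfderiv 𝓘(ℝ, E) 𝓘(ℝ, E) (fun y => Θ g * y) (Θ 1) : E → E) =
      mfderiv 𝓘(ℝ, E) 𝓘(ℝ, E) (fun y => Θ g * y) (1 : G) := by
    rw [map_one]
  have e5 : (mfderiv 𝓘(ℝ, E) 𝓘(ℝ, E) Θ g : E → E) (mulInvariantVectorField v g) =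
      mulInvariantVectorField (I := 𝓘(ℝ, E)) (differential E Θ v) (Θ g) :=
    (congrFun e3 _).symm.trans ((DFunLike.congr_fun e1 v).trans (congrFun e4 _))
  rw [mpullback_apply, hinv]
  refine (congrArg (mfderiv 𝓘(ℝ, E) 𝓘(ℝ, E) Θ (Θ g) : E → E) e5.symm).trans ?_
  exact h.mfderiv_mfderiv rfl _

/-- Pullback by a diffeomorphism commutes with the bracket of vector fields; apply this to the
left-invariant fields of dΘ v and dΘ w, evaluate at the identity and apply dΘ. -/
theorem differential_lie [FiniteDimensional ℝ E] {Θ : G ≃* G} (h : IsInvolution E Θ)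
    (v w : GroupLieAlgebra 𝓘(ℝ, E) G) :
    differential E Θ ⁅v, w⁆ = ⁅differential E Θ v, differential E Θ w⁆ := by
  have : CompleteSpace E := FiniteDimensional.complete ℝ E
  have : IsManifold 𝓘(ℝ, E) (minSmoothness ℝ 3) G := inferInstance
  have hpull := mpullback_mlieBracket (I := 𝓘(ℝ, E)) (I' := 𝓘(ℝ, E)) (f := Θ) (x₀ := (1 : G))
    (V := mulInvariantVectorField (differential E Θ v))
    (W := mulInvariantVectorField (differential E Θ w)) (n := ∞)
    (mdifferentiableAt_mulInvariantVectorField _) (mdifferentiableAt_mulInvariantVectorField _)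
    h.contMDiff.contMDiffAt
    (by simp only [minSmoothness_of_isRCLikeNormedField]; exact ENat.LEInfty.out)
  rw [h.mpullback_mulInvariantVectorField, h.mpullback_mulInvariantVectorField] at hpull
  have hinv : (mfderiv 𝓘(ℝ, E) 𝓘(ℝ, E) Θ (1 : G)).inverse = mfderiv 𝓘(ℝ, E) 𝓘(ℝ, E) Θ (Θ 1) :=
    ContinuousLinearMap.inverse_eq
      (ContinuousLinearMap.ext fun v => h.mfderiv_mfderiv (h.apply_apply 1) v)
      (ContinuousLinearMap.ext fun v => h.mfderiv_mfderiv rfl v)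
  rw [mpullback_apply, hinv] at hpull
  rw [GroupLieAlgebra.bracket_def, ← hpull]
  refine (h.mfderiv_mfderiv (g := Θ 1) (g' := 1) (h.apply_apply 1) _).trans ?_
  rw [GroupLieAlgebra.bracket_def, map_one]

end Group

end SymmTriad

namespace SymmTriad

noncomputable section

/-! ### Conjugation and the Hermitian form on the complexified Lie algebra. -/

section Complexification

variable {L : Type*} [LieRing L] [LieAlgebra ℝ L]

variable (L) in
/-- The bracket of the Lie ring `ℂ ⊗ L`, in the form in which `LieAlgebra.ad` uses it. -/
@[reducible] def complexBracket : Bracket (ℂ ⊗[ℝ] L) (ℂ ⊗[ℝ] L) :=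
  (lieRingSelfModule : LieRingModule (ℂ ⊗[ℝ] L) (ℂ ⊗[ℝ] L)).toBracket

attribute [local instance] complexBracket

theorem lie_tmul_tmul (c d : ℂ) (x y : L) : ⁅c ⊗ₜ[ℝ] x, d ⊗ₜ[ℝ] y⁆ = (c * d) ⊗ₜ[ℝ] ⁅x, y⁆ := rfl

theorem complex_smul_lie (c : ℂ) (X Y : ℂ ⊗[ℝ] L) : ⁅c • X, Y⁆ = c • ⁅X, Y⁆ :=
  DFunLike.congr_fun (map_smul (LieAlgebra.ad ℂ (ℂ ⊗[ℝ] L)) c X) Y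

theorem complex_lie_smul (c : ℂ) (X Y : ℂ ⊗[ℝ] L) : ⁅X, c • Y⁆ = c • ⁅X, Y⁆ :=
  (LieAlgebra.ad ℂ (ℂ ⊗[ℝ] L) X).map_smul c Y

theorem tmul_real_smul (c : ℝ) (x : L) :
    (1 : ℂ) ⊗ₜ[ℝ] (c • x) = (c : ℂ) • ((1 : ℂ) ⊗ₜ[ℝ] x) := by
  rw [← TensorProduct.smul_tmul, TensorProduct.smul_tmul']
  simp

theorem exists_tmul_add_smul_tmul (X : ℂ ⊗[ℝ] L) :
    ∃ x y : L, X = (1 : ℂ) ⊗ₜ[ℝ] x + Complex.I • ((1 : ℂ) ⊗ₜ[ℝ] y) := by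
  induction X using TensorProduct.induction_on with
  | zero => exact ⟨0, 0, by simp⟩
  | tmul c x =>
    refine ⟨c.re • x, c.im • x, ?_⟩
    rw [← TensorProduct.smul_tmul, ← TensorProduct.smul_tmul, TensorProduct.smul_tmul',
      ← TensorProduct.add_tmul]
    congr 1
    apply Complex.ext <;> simp
  | add X Y hX hY =>
    obtain ⟨x, y, rfl⟩ := hX
    obtain ⟨x', y', rfl⟩ := hY
    exact ⟨x + x', y + y', by simp only [TensorProduct.tmul_add, smul_add]; abel⟩

variable (L) in
/-- Complex conjugation on `ℂ ⊗ L`. -/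
def conjMap : ℂ ⊗[ℝ] L →ₗ[ℝ] ℂ ⊗[ℝ] L :=
  LinearMap.rTensor L Complex.conjAe.toLinearMap

@[simp] theorem conjMap_tmul (c : ℂ) (x : L) :
    conjMap L (c ⊗ₜ[ℝ] x) = (starRingEnd ℂ c) ⊗ₜ[ℝ] x := rfl

theorem conjMap_smul (c : ℂ) (X : ℂ ⊗[ℝ] L) :
    conjMap L (c • X) = (starRingEnd ℂ c) • conjMap L X := by
  induction X using TensorProduct.induction_on with
  | zero => simp
  | tmul d x => simp [TensorProduct.smul_tmul']
  | add X Y hX hY => rw [smul_add, map_add, hX, hY, map_add, smul_add]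

theorem conjMap_conjMap (X : ℂ ⊗[ℝ] L) : conjMap L (conjMap L X) = X := by
  induction X using TensorProduct.induction_on with
  | zero => simp
  | tmul d x => simp
  | add X Y hX hY => rw [map_add, map_add, hX, hY]

theorem conjMap_lie (X Y : ℂ ⊗[ℝ] L) : conjMap L ⁅X, Y⁆ = ⁅conjMap L X, conjMap L Y⁆ := by
  induction X using TensorProduct.induction_on with
  | zero => simp
  | add X X' hX hX' => simp only [add_lie, map_add, hX, hX']
  | tmul c x =>
    induction Y using TensorProduct.induction_on with
    | zero => simp
    | add Y Y' hY hY' => simp only [lie_add, map_add, hY, hY']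
    | tmul d y => simp

/-- The complex bilinear extension of an invariant inner product. -/
def InvariantInnerProduct.cform (B : InvariantInnerProduct L) :
    LinearMap.BilinForm ℂ (ℂ ⊗[ℝ] L) :=
  B.form.baseChange ℂ

variable (B : InvariantInnerProduct L)

@[simp] theorem cform_tmul (c d : ℂ) (x y : L) :
    B.cform (c ⊗ₜ[ℝ] x) (d ⊗ₜ[ℝ] y) = (B.form x y : ℂ) * (c * d) := by
  rw [InvariantInnerProduct.cform, LinearMap.BilinForm.baseChange_tmul, Complex.real_smul]

theorem cform_symm (X Y : ℂ ⊗[ℝ] L) : B.cform X Y = B.cform Y X := by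
  induction X using TensorProduct.induction_on with
  | zero => simp
  | add X X' hX hX' => simp only [LinearMap.add_apply, map_add, hX, hX']
  | tmul c x =>
    induction Y using TensorProduct.induction_on with
    | zero => simp
    | add Y Y' hY hY' => simp only [LinearMap.add_apply, map_add, hY, hY']
    | tmul d y => simp only [cform_tmul, B.symm x y, mul_comm c d]

theorem cform_conjMap (X Y : ℂ ⊗[ℝ] L) :
    B.cform (conjMap L X) (conjMap L Y) = starRingEnd ℂ (B.cform X Y) := by
  induction X using TensorProduct.induction_on with
  | zero => simp
  | add X X' hX hX' => simp only [LinearMap.add_apply, map_add, hX, hX']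
  | tmul c x =>
    induction Y using TensorProduct.induction_on with
    | zero => simp
    | add Y Y' hY hY' => simp only [map_add, hY, hY']
    | tmul d y => simp

theorem cform_lie (X Y Z : ℂ ⊗[ℝ] L) : B.cform ⁅X, Y⁆ Z = - B.cform Y ⁅X, Z⁆ := by
  induction X using TensorProduct.induction_on with
  | zero => simp
  | add X X' hX hX' => simp only [add_lie, LinearMap.add_apply, map_add, hX, hX', neg_add]
  | tmul c x =>
    induction Y using TensorProduct.induction_on with
    | zero => simp
    | add Y Y' hY hY' => simp only [lie_add, LinearMap.add_apply, map_add, hY, hY', neg_add]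
    | tmul d y =>
      induction Z using TensorProduct.induction_on with
      | zero => simp
      | add Z Z' hZ hZ' => simp only [lie_add, map_add, hZ, hZ', neg_add]
      | tmul e z =>
        simp only [lie_tmul_tmul, cform_tmul, B.invariant x y z]
        push_cast
        ring

/-- The Hermitian form on `ℂ ⊗ L` extending an invariant inner product on `L`. -/
def InvariantInnerProduct.herm (X Y : ℂ ⊗[ℝ] L) : ℂ := B.cform (conjMap L X) Y

theorem herm_self_tmul_add_smul_tmul (x y : L) :
    B.herm ((1 : ℂ) ⊗ₜ[ℝ] x + Complex.I • ((1 : ℂ) ⊗ₜ[ℝ] y))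
      ((1 : ℂ) ⊗ₜ[ℝ] x + Complex.I • ((1 : ℂ) ⊗ₜ[ℝ] y)) = (B.form x x + B.form y y : ℝ) := by
  simp only [InvariantInnerProduct.herm, map_add, conjMap_smul, conjMap_tmul, map_one,
    Complex.conj_I, LinearMap.add_apply, LinearMap.map_smul, LinearMap.smul_apply, cform_tmul,
    B.symm y x, smul_eq_mul]
  push_cast
  linear_combination -(B.form y y : ℂ) * Complex.I_sq

theorem InvariantInnerProduct.form_self_nonneg (x : L) : 0 ≤ B.form x x := by
  rcases eq_or_ne x 0 with rfl | h
  · simp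
  · exact (B.pos x h).le

theorem InvariantInnerProduct.eq_zero_of_form_self {x : L} (h : B.form x x = 0) : x = 0 := by
  by_contra h0
  exact (B.pos x h0).ne' h

/-- The Hermitian inner product on `ℂ ⊗ L` extending an invariant inner product on `L`. -/
@[reducible] def InvariantInnerProduct.hermCore : InnerProductSpace.Core ℂ (ℂ ⊗[ℝ] L) where
  inner := B.herm
  conj_inner_symm X Y := by
    simp only [InvariantInnerProduct.herm]
    rw [← cform_conjMap, conjMap_conjMap, cform_symm]
  re_inner_nonneg X := by
    obtain ⟨x, y, rfl⟩ := exists_tmul_add_smul_tmul X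
    rw [herm_self_tmul_add_smul_tmul]
    simpa using add_nonneg (B.form_self_nonneg x) (B.form_self_nonneg y)
  add_left X Y Z := by simp [InvariantInnerProduct.herm]
  smul_left X Y c := by simp [InvariantInnerProduct.herm, conjMap_smul]
  definite X h := by
    obtain ⟨x, y, rfl⟩ := exists_tmul_add_smul_tmul X
    rw [herm_self_tmul_add_smul_tmul] at h
    have h1 : B.form x x + B.form y y = 0 := by exact_mod_cast h
    have hx := B.form_self_nonneg x
    have hy := B.form_self_nonneg y
    rw [B.eq_zero_of_form_self (x := x) (by linarith),
      B.eq_zero_of_form_self (x := y) (by linarith)]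
    simp

theorem herm_add_right (X Y Z : ℂ ⊗[ℝ] L) : B.herm X (Y + Z) = B.herm X Y + B.herm X Z := by
  simp [InvariantInnerProduct.herm]

theorem herm_smul_right (c : ℂ) (X Y : ℂ ⊗[ℝ] L) : B.herm X (c • Y) = c * B.herm X Y := by
  simp [InvariantInnerProduct.herm]

theorem herm_smul_left (c : ℂ) (X Y : ℂ ⊗[ℝ] L) :
    B.herm (c • X) Y = starRingEnd ℂ c * B.herm X Y :=
  B.hermCore.smul_left X Y c

theorem herm_self_eq_zero {X : ℂ ⊗[ℝ] L} (h : B.herm X X = 0) : X = 0 :=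
  B.hermCore.definite X h

theorem exists_herm_self (X : ℂ ⊗[ℝ] L) : ∃ r : ℝ, 0 ≤ r ∧ B.herm X X = r := by
  obtain ⟨x, y, rfl⟩ := exists_tmul_add_smul_tmul X
  exact ⟨_, add_nonneg (B.form_self_nonneg x) (B.form_self_nonneg y),
    herm_self_tmul_add_smul_tmul B x y⟩

/-- A real element is fixed by conjugation, so invariance makes its ad skew-Hermitian. The
orthogonality of root spaces and their spanning both rest on this. -/
theorem herm_lie_tmul (H : L) (X Y : ℂ ⊗[ℝ] L) :
    B.herm ⁅(1 : ℂ) ⊗ₜ[ℝ] H, X⁆ Y = - B.herm X ⁅(1 : ℂ) ⊗ₜ[ℝ] H, Y⁆ := by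
  simp only [InvariantInnerProduct.herm, conjMap_lie, conjMap_tmul, map_one, cform_lie]

theorem tmul_add_smul_tmul_eq_zero {x y : L}
    (h : (1 : ℂ) ⊗ₜ[ℝ] x + Complex.I • ((1 : ℂ) ⊗ₜ[ℝ] y) = 0) (B : InvariantInnerProduct L) :
    x = 0 ∧ y = 0 := by
  have h1 := herm_self_tmul_add_smul_tmul B x y
  rw [h] at h1
  have h2 : B.form x x + B.form y y = 0 := by
    have h3 : B.herm (0 : ℂ ⊗[ℝ] L) 0 = 0 := by simp [InvariantInnerProduct.herm]
    rw [h3] at h1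
    exact_mod_cast h1.symm
  have hx := B.form_self_nonneg x
  have hy := B.form_self_nonneg y
  exact ⟨B.eq_zero_of_form_self (by linarith), B.eq_zero_of_form_self (by linarith)⟩

end Complexification

/-! ### Root spaces: orthogonality, one-dimensionality and spanning. -/

section RootSpaces

attribute [local instance] complexBracket

variable {L : Type*} [LieRing L] [LieAlgebra ℝ L] (B : InvariantInnerProduct L)

theorem mem_rootSpace {s : Submodule ℝ L} {α : L} {X : ℂ ⊗[ℝ] L} :
    X ∈ rootSpace B s α ↔
      ∀ H ∈ s, ⁅(1 : ℂ) ⊗ₜ[ℝ] H, X⁆ = (Complex.I * (B.form α H : ℂ)) • X := by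
  simp [rootSpace, Submodule.mem_iInf]

theorem herm_eq_zero_of_lie_eq {H : L} {p q : ℝ} (hpq : p ≠ q) {X Y : ℂ ⊗[ℝ] L}
    (hX : ⁅(1 : ℂ) ⊗ₜ[ℝ] H, X⁆ = (Complex.I * (p : ℂ)) • X)
    (hY : ⁅(1 : ℂ) ⊗ₜ[ℝ] H, Y⁆ = (Complex.I * (q : ℂ)) • Y) : B.herm X Y = 0 := by
  have h := herm_lie_tmul B H X Y
  rw [hX, hY, herm_smul_left, herm_smul_right] at h
  simp only [map_mul, Complex.conj_I, Complex.conj_ofReal] at h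
  have h1 : Complex.I * ((p : ℂ) - q) * B.herm X Y = 0 := by linear_combination -h
  have h2 : (p : ℂ) - q ≠ 0 := sub_ne_zero.mpr (by exact_mod_cast hpq)
  simpa [h2] using h1

theorem eq_of_forall_form_eq {s : Submodule ℝ L} {α β : L} (hα : α ∈ s) (hβ : β ∈ s)
    (h : ∀ H ∈ s, B.form α H = B.form β H) : α = β := by
  refine sub_eq_zero.mp (B.eq_zero_of_form_self ?_)
  rw [LinearMap.map_sub₂, h _ (s.sub_mem hα hβ), sub_self]

theorem herm_eq_zero_of_mem_rootSpace {t : Submodule ℝ L} {α β : L} (hα : α ∈ t) (hβ : β ∈ t)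
    (hne : α ≠ β) {X Y : ℂ ⊗[ℝ] L} (hX : X ∈ rootSpace B t α) (hY : Y ∈ rootSpace B t β) :
    B.herm X Y = 0 := by
  by_contra h0
  refine hne (eq_of_forall_form_eq B hα hβ fun H hH => ?_)
  by_contra h1
  exact h0 (herm_eq_zero_of_lie_eq B h1 ((mem_rootSpace B).mp hX H hH)
    ((mem_rootSpace B).mp hY H hH))

theorem eq_of_mem_rootSpace {t : Submodule ℝ L} {α β : L} (hα : α ∈ t) (hβ : β ∈ t)
    {X : ℂ ⊗[ℝ] L} (h0 : X ≠ 0) (hX : X ∈ rootSpace B t α) (hY : X ∈ rootSpace B t β) :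
    α = β := by
  by_contra hne
  exact h0 (herm_self_eq_zero B (herm_eq_zero_of_mem_rootSpace B hα hβ hne hX hY))

theorem conjMap_mem_rootSpace {t : Submodule ℝ L} {α : L} {X : ℂ ⊗[ℝ] L}
    (hX : X ∈ rootSpace B t α) : conjMap L X ∈ rootSpace B t (-α) := by
  rw [mem_rootSpace] at hX ⊢
  intro H hH
  have h := congrArg (conjMap L) (hX H hH)
  rw [conjMap_lie, conjMap_smul] at h
  simpa using h

theorem lie_mem_rootSpace {t : Submodule ℝ L} {α β : L} {X Y : ℂ ⊗[ℝ] L}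
    (hX : X ∈ rootSpace B t α) (hY : Y ∈ rootSpace B t β) : ⁅X, Y⁆ ∈ rootSpace B t (α + β) := by
  rw [mem_rootSpace] at hX hY ⊢
  intro H hH
  rw [leibniz_lie, hX H hH, hY H hH, complex_smul_lie, complex_lie_smul, ← add_smul]
  congr 1
  simp
  ring

/-- Adjoining x to t would give a larger abelian subspace of V. -/
theorem mem_of_forall_lie_eq_zero {V t : Submodule ℝ L} (ht : IsMaximalAbelian V t) {x : L}
    (hxV : x ∈ V) (hx : ∀ H ∈ t, ⁅H, x⁆ = 0) : x ∈ t := by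
  have hprop : (fun u : Submodule ℝ L => u ≤ V ∧ ∀ x ∈ u, ∀ y ∈ u, ⁅x, y⁆ = 0)
      (t ⊔ Submodule.span ℝ {x}) := by
    refine ⟨sup_le ht.prop.1 (by simpa using hxV), ?_⟩
    intro y hy z hz
    obtain ⟨y, hyt, _, hy', rfl⟩ := Submodule.mem_sup.mp hy
    obtain ⟨z, hzt, _, hz', rfl⟩ := Submodule.mem_sup.mp hz
    obtain ⟨c, rfl⟩ := Submodule.mem_span_singleton.mp hy'
    obtain ⟨d, rfl⟩ := Submodule.mem_span_singleton.mp hz'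
    have h1 : ⁅x, z⁆ = 0 := by rw [← lie_skew, hx z hzt, neg_zero]
    simp [ht.prop.2 y hyt z hzt, hx y hyt, h1]
  exact ht.le_of_ge hprop le_sup_left
    (Submodule.mem_sup_right (Submodule.mem_span_singleton_self x))

/-- The centralizer of a maximal abelian subalgebra meets its orthogonal complement trivially. -/
theorem eq_zero_of_mem_rootSpace_zero {t : Submodule ℝ L} (ht : IsMaximalAbelian ⊤ t)
    {Z : ℂ ⊗[ℝ] L} (hZ : Z ∈ rootSpace B t 0)
    (h : ∀ H ∈ t, B.cform Z ((1 : ℂ) ⊗ₜ[ℝ] H) = 0) : Z = 0 := by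
  obtain ⟨x, y, rfl⟩ := exists_tmul_add_smul_tmul Z
  have hxy : ∀ H ∈ t, ⁅H, x⁆ = 0 ∧ ⁅H, y⁆ = 0 := fun H hH => by
    refine tmul_add_smul_tmul_eq_zero ?_ B
    have := (mem_rootSpace B).mp hZ H hH
    simpa [lie_tmul_tmul] using this
  have hx : x ∈ t := mem_of_forall_lie_eq_zero ht trivial fun H hH => (hxy H hH).1
  have hy : y ∈ t := mem_of_forall_lie_eq_zero ht trivial fun H hH => (hxy H hH).2
  have key : ∀ H ∈ t, B.form x H = 0 ∧ B.form y H = 0 := fun H hH => by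
    have := h H hH
    simp only [map_add, LinearMap.add_apply, LinearMap.map_smul, LinearMap.smul_apply,
      cform_tmul, smul_eq_mul, mul_one] at this
    constructor
    · simpa using congrArg Complex.re this
    · simpa using congrArg Complex.im this
  rw [B.eq_zero_of_form_self (key x hx).1, B.eq_zero_of_form_self (key y hy).2]
  simp

theorem cform_conjMap_lie_tmul {t : Submodule ℝ L} {α : L} {E X : ℂ ⊗[ℝ] L}
    (hE : E ∈ rootSpace B t α) {H : L} (hH : H ∈ t) :
    B.cform ⁅conjMap L E, X⁆ ((1 : ℂ) ⊗ₜ[ℝ] H) = -(Complex.I * (B.form α H : ℂ)) * B.herm E X := by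
  have h1 := (mem_rootSpace B).mp (conjMap_mem_rootSpace B hE) H hH
  rw [cform_lie, ← lie_skew, h1, InvariantInnerProduct.herm, cform_symm B _ X]
  simp

/-- An 𝔰𝔩₂-type positivity argument: if X is orthogonal to E in the same root space, then the
conjugate of E kills X, and this forces |[E, X]|² to be a negative multiple of |X|². -/
theorem eq_zero_of_herm_eq_zero {t : Submodule ℝ L} (ht : IsMaximalAbelian ⊤ t) {α : L}
    (hα : α ∈ t) (hα0 : α ≠ 0) {E X : ℂ ⊗[ℝ] L} (hE0 : E ≠ 0) (hE : E ∈ rootSpace B t α)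
    (hX : X ∈ rootSpace B t α) (hEX : B.herm E X = 0) : X = 0 := by
  have hF := conjMap_mem_rootSpace B hE
  have hFX : ⁅conjMap L E, X⁆ = 0 := by
    refine eq_zero_of_mem_rootSpace_zero B ht ?_ fun H hH => ?_
    · simpa using lie_mem_rootSpace B hF hX
    · rw [cform_conjMap_lie_tmul B hE hH, hEX, mul_zero]
  obtain ⟨n, hn, hn'⟩ := exists_herm_self B E
  have hn0 : n ≠ 0 := by
    rintro rfl
    exact hE0 (herm_self_eq_zero B (by simpa using hn'))
  have hα' : (1 : ℂ) ⊗ₜ[ℝ] α ∈ rootSpace B t 0 := by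
    rw [mem_rootSpace]
    intro H hH
    simp [ht.prop.2 H hH α hα]
  -- The bracket of the conjugate of E with E has weight 0, hence is determined by its pairings with
  -- t; comparison gives -i n α, where n = |E|².
  have hFE : ⁅conjMap L E, E⁆ + (Complex.I * (n : ℂ)) • ((1 : ℂ) ⊗ₜ[ℝ] α) = 0 := by
    refine eq_zero_of_mem_rootSpace_zero B ht ?_ fun H hH => ?_
    · refine Submodule.add_mem _ ?_ (Submodule.smul_mem _ _ hα')
      simpa using lie_mem_rootSpace B hF hE
    · rw [map_add, LinearMap.add_apply, cform_conjMap_lie_tmul B hE hH, hn', LinearMap.map_smul,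
        LinearMap.smul_apply, cform_tmul, smul_eq_mul]
      ring
  -- Jacobi identity: one term vanishes by `hFX`, the other is -i n [α, X] = n⟨α, α⟩X.
  have hFEX : ⁅conjMap L E, ⁅E, X⁆⁆ = ((n * B.form α α : ℝ) : ℂ) • X := by
    rw [leibniz_lie, hFX, lie_zero, add_zero, eq_neg_of_add_eq_zero_left hFE, neg_lie, complex_smul_lie,
      (mem_rootSpace B).mp hX α hα, smul_smul, ← neg_smul]
    congr 1
    push_cast
    linear_combination -(n * B.form α α : ℂ) * Complex.I_sq
  obtain ⟨r, hr, hr'⟩ := exists_herm_self B ⁅E, X⁆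
  obtain ⟨q, hq, hq'⟩ := exists_herm_self B X
  have h : B.herm ⁅E, X⁆ ⁅E, X⁆ = -(((n * B.form α α : ℝ) : ℂ) * B.herm X X) := by
    conv_lhs => rw [InvariantInnerProduct.herm, conjMap_lie, cform_lie, hFEX]
    simp [InvariantInnerProduct.herm]
  rw [hr', hq'] at h
  have h' : r = -(n * B.form α α * q) := by exact_mod_cast h
  have hpos : 0 < n * B.form α α := mul_pos (lt_of_le_of_ne hn hn0.symm) (B.pos α hα0)
  have hq0 : q = 0 := by nlinarith
  exact herm_self_eq_zero B (by rw [hq', hq0]; simp)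

/-- The root spaces for a maximal abelian subalgebra are one-dimensional. -/
theorem rootSpace_eq_span_singleton {t : Submodule ℝ L} (ht : IsMaximalAbelian ⊤ t) {α : L}
    (hα : α ∈ t) (hα0 : α ≠ 0) {E : ℂ ⊗[ℝ] L} (hE0 : E ≠ 0) (hE : E ∈ rootSpace B t α) :
    rootSpace B t α = Submodule.span ℂ {E} := by
  refine le_antisymm (fun X hX => ?_) (by simpa using hE)
  have hEE : B.herm E E ≠ 0 := fun h => hE0 (herm_self_eq_zero B h)
  -- The Gram–Schmidt remainder of X with respect to E is orthogonal to E, hence zero.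
  have h := eq_zero_of_herm_eq_zero B ht hα hα0 hE0 hE
    (Submodule.add_mem _ hX (Submodule.smul_mem _ (-(B.herm E X / B.herm E E)) hE)) (by
      rw [herm_add_right, herm_smul_right]
      field_simp
      ring)
  rw [Submodule.mem_span_singleton]
  exact ⟨B.herm E X / B.herm E E, by rw [← sub_eq_zero, ← neg_eq_zero, ← h, neg_smul]; abel⟩

/-- Positive definiteness makes the form nondegenerate on every subspace. This turns weights, which
arise as functionals, into vectors of t. -/
theorem exists_form_eq [FiniteDimensional ℝ L] (t : Submodule ℝ L) (φ : t →ₗ[ℝ] ℝ) :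
    ∃ α ∈ t, ∀ H : t, B.form α H = φ H := by
  let f : t →ₗ[ℝ] (t →ₗ[ℝ] ℝ) := (B.form.domRestrict₁₂ t t)
  have hinj : Function.Injective f := by
    rw [injective_iff_map_eq_zero]
    intro x hx
    exact Subtype.ext (B.eq_zero_of_form_self (DFunLike.congr_fun hx x))
  have hsurj : Function.Surjective f :=
    (LinearMap.injective_iff_surjective_of_finrank_eq_finrank
      (Subspace.dual_finrank_eq (K := ℝ) (V := t)).symm).mp hinj
  obtain ⟨α, hα⟩ := hsurj φ
  exact ⟨α, α.2, fun H => DFunLike.congr_fun hα H⟩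

/-- The root spaces for an abelian subspace span `ℂ ⊗ L`. -/
theorem iSup_rootSpace_eq_top [FiniteDimensional ℝ L] {t : Submodule ℝ L}
    (ht : ∀ x ∈ t, ∀ y ∈ t, ⁅x, y⁆ = 0) : ⨆ α : t, rootSpace B t α = ⊤ := by
  let := B.hermCore.toNormedAddCommGroup
  let : InnerProductSpace ℂ (ℂ ⊗[ℝ] L) := InnerProductSpace.ofCore B.hermCore.toCore
  -- The factor i turns skew-Hermitian operators into symmetric ones, so that joint diagonalization
  -- applies.
  let T : t → ((ℂ ⊗[ℝ] L) →ₗ[ℂ] (ℂ ⊗[ℝ] L)) := fun H =>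
    Complex.I • (LieAlgebra.ad ℂ (ℂ ⊗[ℝ] L) ((1 : ℂ) ⊗ₜ[ℝ] (H : L)))
  have hT : ∀ H X, T H X = Complex.I • ⁅(1 : ℂ) ⊗ₜ[ℝ] (H : L), X⁆ := fun H X => rfl
  have hsymm : ∀ H, (T H).IsSymmetric := fun H X Y => by
    change B.herm (T H X) Y = B.herm X (T H Y)
    rw [hT, hT, herm_smul_left, herm_smul_right, herm_lie_tmul]
    simp
  have hcomm : Pairwise (Function.onFun Commute T) := fun H K _ => by
    refine LinearMap.ext fun X => ?_
    change T H (T K X) = T K (T H X)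
    simp only [hT, complex_lie_smul]
    rw [leibniz_lie]
    simp [ht H H.2 K K.2]
  rw [eq_top_iff, ← LinearMap.IsSymmetric.iSup_iInf_eq_top_of_commute hsymm hcomm]
  refine iSup_le fun χ => ?_
  by_cases hbot : (⨅ H, Module.End.eigenspace (T H) (χ H)) = ⊥
  · rw [hbot]; exact bot_le
  obtain ⟨X, hX, hX0⟩ := Submodule.exists_mem_ne_zero_of_ne_bot hbot
  have hTX : ∀ {Y}, Y ∈ (⨅ H, Module.End.eigenspace (T H) (χ H)) →
      ∀ H : t, Complex.I • ⁅(1 : ℂ) ⊗ₜ[ℝ] (H : L), Y⁆ = χ H • Y := fun {Y} hY H => by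
    rw [← hT]
    exact Module.End.mem_eigenspace_iff.mp ((Submodule.mem_iInf _).mp hY H)
  have hXX : B.herm X X ≠ 0 := fun h => hX0 (herm_self_eq_zero B h)
  have hreal : ∀ H, ((χ H).re : ℂ) = χ H := fun H => by
    have h : B.herm (T H X) X = B.herm X (T H X) := hsymm H X X
    rw [hT, hTX hX H, herm_smul_left, herm_smul_right] at h
    exact Complex.conj_eq_iff_re.mp (mul_right_cancel₀ hXX h)
  have hinj : ∀ {c d : ℂ}, c • X = d • X → c = d := fun h => smul_left_injective ℂ hX0 h
  -- The eigenvalues on the joint eigenvector X depend linearly on H. The minus sign comes from i[H,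
  -- Y] = χ(H)Y, that is, [H, Y] = -iχ(H)Y.
  let φ : t →ₗ[ℝ] ℝ :=
    { toFun := fun (H : t) => -(χ H).re
      map_add' := fun (H K : t) => by
        have : χ (H + K) = χ H + χ K := hinj (by
          rw [add_smul, ← hTX hX, ← hTX hX, ← hTX hX, ← smul_add, ← add_lie,
            ← TensorProduct.tmul_add]; rfl)
        rw [this, Complex.add_re]; ring
      map_smul' := fun c (H : t) => by
        have : χ (c • H) = (c : ℂ) * χ H := hinj (by
          rw [mul_smul, ← hTX hX, ← hTX hX, Submodule.coe_smul, tmul_real_smul, complex_smul_lie,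
            smul_comm])
        rw [this]; simp }
  obtain ⟨α, hα, hφ⟩ := exists_form_eq B t φ
  refine le_trans (fun Y hY => ?_) (le_iSup (fun α : t => rootSpace B t α) ⟨α, hα⟩)
  rw [mem_rootSpace]
  intro H hH
  have h1 := hTX hY ⟨H, hH⟩
  have h2 : B.form α H = -(χ ⟨H, hH⟩).re := hφ ⟨H, hH⟩
  rw [h2]
  push_cast
  rw [hreal, mul_neg, neg_smul, mul_smul, ← h1, smul_smul, Complex.I_mul_I]
  simp

end RootSpaces

end

end SymmTriad

namespace SymmTriad

noncomputable section

/-! ### Involutive automorphisms of a simple Lie algebra are isometries. -/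

section Isometry

variable {L : Type*} [LieRing L] [LieAlgebra ℝ L] (B : InvariantInnerProduct L)

/-- The real inner product given by an invariant inner product. -/
@[reducible] def InvariantInnerProduct.realCore : InnerProductSpace.Core ℝ L where
  inner x y := B.form x y
  conj_inner_symm x y := by simpa using B.symm y x
  re_inner_nonneg x := by simpa using B.form_self_nonneg x
  add_left x y z := by simp
  smul_left x y c := by simp
  definite x h := B.eq_zero_of_form_self h

theorem exists_hasEigenvalue [FiniteDimensional ℝ L] [Nontrivial L] {S : Module.End ℝ L}
    (hS : ∀ x y, B.form (S x) y = B.form x (S y)) : ∃ c : ℝ, S.eigenspace c ≠ ⊥ := by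
  let := B.realCore.toNormedAddCommGroup
  let : InnerProductSpace ℝ L := InnerProductSpace.ofCore B.realCore.toCore
  have hsymm : LinearMap.IsSymmetric S := hS
  by_contra! h
  have h1 := hsymm.orthogonalComplement_iSup_eigenspaces_eq_bot
  simp only [h, iSup_bot] at h1
  simp at h1

/-- An involutive automorphism of a simple Lie algebra preserves every invariant inner product. -/
theorem form_map_map [FiniteDimensional ℝ L] (hsimple : LieAlgebra.IsSimple ℝ L)
    {θ : Module.End ℝ L} (hlie : ∀ x y, θ ⁅x, y⁆ = ⁅θ x, θ y⁆) (hsq : θ * θ = 1) (x y : L) :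
    B.form (θ x) (θ y) = B.form x y := by
  have hθθ : ∀ x, θ (θ x) = x := fun x => DFunLike.congr_fun hsq x
  have hnd : B.form.Nondegenerate :=
    ⟨fun x h => B.eq_zero_of_form_self (h x), fun x h => B.eq_zero_of_form_self (h x)⟩
  have : Nontrivial L := by
    by_contra h
    rw [not_nontrivial_iff_subsingleton] at h
    exact hsimple.non_abelian ⟨fun _ _ => Subsingleton.elim _ _⟩
  -- S represents the form pulled back by θ. It is symmetric, so it has a real eigenvalue, and it
  -- commutes with every ad z, so an eigenspace is an ideal; by simplicity S is a scalar c.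
  obtain ⟨S, hS⟩ : ∃ S : Module.End ℝ L, ∀ x y, B.form (S x) y = B.form (θ x) (θ y) := by
    refine ⟨(LinearMap.BilinForm.toDual B.form hnd).symm.toLinearMap ∘ₗ
      (B.form.compl₁₂ θ θ), fun x y => ?_⟩
    simp
  have hsym : ∀ x y, B.form (S x) y = B.form x (S y) := fun x y => by
    rw [hS, B.symm x, hS, B.symm]
  obtain ⟨c, hc⟩ := exists_hasEigenvalue B hsym
  have hcomm : ∀ z x, S ⁅z, x⁆ = ⁅z, S x⁆ := fun z x => by
    refine eq_of_forall_form_eq B (s := ⊤) trivial trivial fun y _ => ?_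
    rw [hS, hlie, B.invariant, B.invariant, ← hlie, hS]
  let I : LieIdeal ℝ L :=
    { S.eigenspace c with
      lie_mem := fun {z x} hx => by
        have hx' : S x = c • x := Module.End.mem_eigenspace_iff.mp hx
        refine Module.End.mem_eigenspace_iff.mpr ?_
        rw [hcomm, hx', lie_smul] }
  have hI : I = ⊤ := by
    refine (hsimple.eq_bot_or_eq_top I).resolve_left fun h => hc ?_
    rw [eq_bot_iff]
    intro x hx
    have : x ∈ I := hx
    rw [h] at this
    simpa using this
  have hSc : ∀ x, S x = c • x := fun x => by
    have : x ∈ I := by rw [hI]; trivial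
    exact Module.End.mem_eigenspace_iff.mp this
  have hform : ∀ x y, B.form (θ x) (θ y) = c * B.form x y := fun x y => by
    rw [← hS, hSc]; simp
  obtain ⟨x₀, hx₀⟩ := exists_ne (0 : L)
  have hpos := B.pos x₀ hx₀
  have h1 := hform (θ x₀) (θ x₀)
  rw [hθθ, hform] at h1
  have h2 := hform x₀ x₀
  have h3 := B.form_self_nonneg (θ x₀)
  -- θ² = 1 scales the form by c², and positivity excludes c = -1.
  have hc2 : c * c = 1 := mul_right_cancel₀ hpos.ne' (by linarith)
  have hc0 : 0 ≤ c := by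
    by_contra! h
    nlinarith
  have hc1 : c = 1 := by nlinarith
  rw [hform, hc1, one_mul]

end Isometry

/-! ### Eigenspace dimensions of a monomial involution. -/

section Trace

/-- The dimension of an eigenspace of an involution permuting a basis up to scalars. -/
theorem two_mul_finrank_eigenspace {V ι : Type*} [AddCommGroup V] [Module ℂ V]
    [Fintype ι] [DecidableEq ι] (b : Module.Basis ι ℂ V) {T : Module.End ℂ V} (hT : T * T = 1)
    (p : ι → ι) (c : ι → ℂ) (hb : ∀ i, T (b i) = c i • b (p i)) {ε : ℂ} (hε : ε * ε = 1) :
    2 * Module.finrank ℂ (T.eigenspace ε) =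
      2 * Nat.card {i // p i = i ∧ c i = ε} + Nat.card {i // p i ≠ i} := by
  classical
  have : FiniteDimensional ℂ V := b.finiteDimensional_of_finite
  have hTT : ∀ x, T (T x) = x := fun x => DFunLike.congr_fun hT x
  -- P is the projection onto the ε-eigenspace, so its trace is the dimension sought.
  let P : Module.End ℂ V := (1 / 2 : ℂ) • (1 + ε • T)
  have hP : ∀ x, P x = (1 / 2 : ℂ) • (x + ε • T x) := fun x => rfl
  have hproj : LinearMap.IsProj (T.eigenspace ε) P :=
    { map_mem := fun x => by
        rw [Module.End.mem_eigenspace_iff, hP, map_smul, map_add, map_smul, hTT, smul_comm ε,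
          smul_add ε, smul_smul ε ε, hε, one_smul, add_comm]
      map_id := fun x hx => by
        rw [Module.End.mem_eigenspace_iff] at hx
        rw [hP, hx, smul_smul, hε, one_smul, ← two_smul ℂ, smul_smul]
        norm_num }
  have htr := hproj.trace
  -- A fixed index has c i = ±ε and contributes 1 or 0 accordingly; a moved index contributes 1/2,
  -- from the identity term alone.
  have hdiag : ∀ i, LinearMap.toMatrix b b P i i =
      1 / 2 * (2 * (if p i = i ∧ c i = ε then 1 else 0) + if p i ≠ i then 1 else 0) := fun i => by
    rw [LinearMap.toMatrix_apply, hP, hb]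
    by_cases hi : p i = i
    · have h1 : c i * c i = 1 := by
        have h2 := hTT (b i)
        rw [hb, hi, map_smul, hb, hi, smul_smul] at h2
        simpa using congrArg (fun x => b.repr x i) h2
      by_cases hc : c i = ε
      · simp [hi, hc, hε]; norm_num
      · have h2 : (c i - ε) * (c i + ε) = 0 := by linear_combination h1 - hε
        have h3 : c i = -ε := by
          rcases mul_eq_zero.mp h2 with h | h
          · exact absurd (sub_eq_zero.mp h) hc
          · exact eq_neg_of_add_eq_zero_left h
        simp only [hi, hc, and_false, if_false, ne_eq, not_true_eq_false]
        simp [h3, hε]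
    · simp [hi]
  rw [LinearMap.trace_eq_matrix_trace ℂ b, Matrix.trace] at htr
  simp only [Matrix.diag_apply, hdiag] at htr
  rw [← Finset.mul_sum, Finset.sum_add_distrib, ← Finset.mul_sum, Finset.sum_boole,
    Finset.sum_boole] at htr
  rw [Nat.card_eq_fintype_card, Nat.card_eq_fintype_card, Fintype.card_subtype,
    Fintype.card_subtype]
  have h : ((2 * Module.finrank ℂ (T.eigenspace ε) : ℕ) : ℂ) = ((2 *
      (Finset.univ.filter fun i => p i = i ∧ c i = ε).card +
      (Finset.univ.filter fun i => p i ≠ i).card : ℕ) : ℂ) := by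
    push_cast
    rw [← htr]
    ring
  exact_mod_cast h

end Trace

end

end SymmTriad

namespace SymmTriad

noncomputable section

/-! ### Restricted root spaces as sums of root spaces. -/

section Projection

variable {L : Type*} [LieRing L] [LieAlgebra ℝ L] [FiniteDimensional ℝ L]
  (B : InvariantInnerProduct L)

theorem proj_mem (a : Submodule ℝ L) (x : L) : B.proj a x ∈ a :=
  Submodule.projection_apply_mem _ x

theorem form_proj (a : Submodule ℝ L) (x : L) {H : L} (hH : H ∈ a) :
    B.form (B.proj a x) H = B.form x H := by
  have h : x - B.proj a x ∈ B.form.orthogonal a := by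
    rw [← Submodule.projection_apply_eq_zero_iff (B.isCompl a)]
    change B.proj a (x - B.proj a x) = 0
    rw [map_sub, sub_eq_zero]
    exact (Submodule.projection_apply_of_mem_left (B.isCompl a) (proj_mem B a x)).symm
  have h1 : B.form (x - B.proj a x) H = 0 := by rw [B.symm]; exact h H hH
  rw [LinearMap.map_sub₂, sub_eq_zero] at h1
  exact h1.symm

theorem proj_eq_iff {a : Submodule ℝ L} {x l : L} (hl : l ∈ a) :
    B.proj a x = l ↔ ∀ H ∈ a, B.form x H = B.form l H := by
  constructor
  · rintro rfl H hH
    exact (form_proj B a x hH).symm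
  · intro h
    exact eq_of_forall_form_eq B (proj_mem B a x) hl fun H hH => by rw [form_proj B a x hH, h H hH]

/-- The `α ∈ t` over `l` with a nonzero root space. -/
def rootsOver (t a : Submodule ℝ L) (l : L) : Set L :=
  {α | α ∈ t ∧ B.proj a α = l ∧ rootSpace B t α ≠ ⊥}

theorem rootSpace_le_rootSpace_proj {t a : Submodule ℝ L} (hat : a ≤ t) (α : L) :
    rootSpace B t α ≤ rootSpace B a (B.proj a α) := fun X hX => by
  rw [mem_rootSpace] at hX ⊢
  intro H hH
  rw [hX H (hat hH), form_proj B a α hH]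

/-- A restricted root space is the sum of the root spaces over it. -/
theorem rootSpace_eq_iSup {t a : Submodule ℝ L} (ht : ∀ x ∈ t, ∀ y ∈ t, ⁅x, y⁆ = 0)
    (hat : a ≤ t) {l : L} (hl : l ∈ a) :
    rootSpace B a l = ⨆ α : rootsOver B t a l, rootSpace B t α := by
  set U := ⨆ α : rootsOver B t a l, rootSpace B t α with hU
  set U' := ⨆ α : {α : t // B.proj a α ≠ l}, rootSpace B t (α : t) with hU'
  have hUle : U ≤ rootSpace B a l := iSup_le fun α =>
    (rootSpace_le_rootSpace_proj B hat _).trans (by rw [α.2.2.1])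
  have htop : U ⊔ U' = ⊤ := by
    rw [eq_top_iff, ← iSup_rootSpace_eq_top B ht]
    refine iSup_le fun α => ?_
    by_cases hα : B.proj a α = l
    · by_cases hbot : rootSpace B t α = ⊥
      · rw [hbot]; exact bot_le
      · exact le_sup_of_le_left
          (le_iSup (fun α : rootsOver B t a l => rootSpace B t α) ⟨α, α.2, hα, hbot⟩)
    · exact le_sup_of_le_right
        (le_iSup (fun α : {α : t // B.proj a α ≠ l} => rootSpace B t (α : t)) ⟨α, hα⟩)
  have hperp : ∀ X ∈ rootSpace B a l, ∀ Y ∈ U', B.herm X Y = 0 := fun X hX Y hY => by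
    refine Submodule.iSup_induction _ (motive := fun Y => B.herm X Y = 0) hY ?_ ?_ ?_
    · intro α Y hY
      by_contra h0
      refine α.2 ((proj_eq_iff B hl).mpr fun H hH => ?_)
      by_contra h1
      exact h0 (herm_eq_zero_of_lie_eq B (Ne.symm h1) ((mem_rootSpace B).mp hX H hH)
        ((mem_rootSpace B).mp hY H (hat hH)))
    · simp [InvariantInnerProduct.herm]
    · intro Y Z hY hZ
      rw [herm_add_right, hY, hZ, add_zero]
  have hdisj : rootSpace B a l ⊓ U' = ⊥ := by
    rw [eq_bot_iff]
    rintro X ⟨hX, hX'⟩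
    exact herm_self_eq_zero B (hperp X hX X hX')
  -- U lies in the restricted root space, U' is orthogonal to it and together they span; the modular
  -- law gives equality with U.
  calc rootSpace B a l = (U ⊔ U') ⊓ rootSpace B a l := by rw [htop, top_inf_eq]
    _ = U ⊔ U' ⊓ rootSpace B a l := sup_inf_assoc_of_le U' hUle
    _ = U := by rw [inf_comm, hdisj, sup_bot_eq]

end Projection

/-! ### The action of σ on the root spaces over a restricted root. -/

section Involution

attribute [local instance] complexBracket

variable {L : Type*} [LieRing L] [LieAlgebra ℝ L] (B : InvariantInnerProduct L)

theorem baseChange_lie {σ : Module.End ℝ L} (hlie : ∀ x y, σ ⁅x, y⁆ = ⁅σ x, σ y⁆)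
    (X Y : ℂ ⊗[ℝ] L) :
    σ.baseChange ℂ ⁅X, Y⁆ = ⁅σ.baseChange ℂ X, σ.baseChange ℂ Y⁆ := by
  induction X using TensorProduct.induction_on with
  | zero => simp
  | add X X' hX hX' => simp only [add_lie, map_add, hX, hX']
  | tmul c x =>
    induction Y using TensorProduct.induction_on with
    | zero => simp
    | add Y Y' hY hY' => simp only [lie_add, map_add, hY, hY']
    | tmul d y => simp only [lie_tmul_tmul, LinearMap.baseChange_tmul, hlie]

theorem baseChange_mem_rootSpace {t : Submodule ℝ L} {σ : Module.End ℝ L}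
    (hlie : ∀ x y, σ ⁅x, y⁆ = ⁅σ x, σ y⁆) (hσ : σ * σ = 1)
    (hform : ∀ x y, B.form (σ x) (σ y) = B.form x y) (hσt : ∀ x ∈ t, σ x ∈ t)
    {α : L} {X : ℂ ⊗[ℝ] L} (hX : X ∈ rootSpace B t α) :
    σ.baseChange ℂ X ∈ rootSpace B t (σ α) := by
  have hσσ : ∀ x, σ (σ x) = x := fun x => DFunLike.congr_fun hσ x
  rw [mem_rootSpace] at hX ⊢
  intro H hH
  have h := congrArg (σ.baseChange ℂ) (hX (σ H) (hσt H hH))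
  rw [baseChange_lie hlie, LinearMap.baseChange_tmul, hσσ, map_smul] at h
  rw [h, ← hform α, hσσ]

/-- The complexification of an eigenspace is the eigenspace of the complexification. -/
theorem eigenspace_baseChange (B : InvariantInnerProduct L) (σ : Module.End ℝ L) (ε : ℝ) :
    Module.End.eigenspace (σ.baseChange ℂ) (ε : ℂ) =
      (Module.End.eigenspace σ ε).baseChange ℂ := by
  refine le_antisymm (fun X hX => ?_) ?_
  · obtain ⟨x, y, rfl⟩ := exists_tmul_add_smul_tmul X
    rw [Module.End.mem_eigenspace_iff, map_add, map_smul, LinearMap.baseChange_tmul,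
      LinearMap.baseChange_tmul] at hX
    -- Since σ and ε are real, the eigenvalue equation splits into real and imaginary parts.
    have h : (1 : ℂ) ⊗ₜ[ℝ] (σ x - ε • x) + Complex.I • ((1 : ℂ) ⊗ₜ[ℝ] (σ y - ε • y)) = 0 := by
      simp only [TensorProduct.tmul_sub, tmul_real_smul, smul_sub]
      rw [smul_add, smul_comm (ε : ℂ) Complex.I, ← sub_eq_zero] at hX
      rw [← hX]
      abel
    obtain ⟨hx, hy⟩ := tmul_add_smul_tmul_eq_zero h B
    refine Submodule.add_mem _ ?_ (Submodule.smul_mem _ _ ?_) <;>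
    · refine Submodule.tmul_mem_baseChange_of_mem _ ?_
      rw [Module.End.mem_eigenspace_iff]
      exact sub_eq_zero.mp (by assumption)
  · rw [Submodule.baseChange_eq_span, Submodule.span_le]
    rintro _ ⟨x, hx, rfl⟩
    have hx' : σ x = ε • x := Module.End.mem_eigenspace_iff.mp hx
    refine Module.End.mem_eigenspace_iff.mpr ?_
    change σ.baseChange ℂ ((1 : ℂ) ⊗ₜ[ℝ] x) = (ε : ℂ) • ((1 : ℂ) ⊗ₜ[ℝ] x)
    rw [LinearMap.baseChange_tmul, hx', tmul_real_smul]

theorem finrank_eigenspace_restrict {V : Type*} [AddCommGroup V] [Module ℂ V]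
    (T : Module.End ℂ V) {U : Submodule ℂ V} (hU : ∀ x ∈ U, T x ∈ U) (ε : ℂ) :
    Module.finrank ℂ (Module.End.eigenspace (T.restrict hU) ε) =
      Module.finrank ℂ (U ⊓ T.eigenspace ε : Submodule ℂ V) := by
  have h : (Module.End.eigenspace (T.restrict hU) ε).map U.subtype = U ⊓ T.eigenspace ε := by
    ext x
    simp only [Submodule.mem_map, Submodule.mem_inf, Module.End.mem_eigenspace_iff]
    constructor
    · rintro ⟨y, hy, rfl⟩
      exact ⟨y.2, congrArg Subtype.val hy⟩
    · rintro ⟨hx, hx'⟩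
      exact ⟨⟨x, hx⟩, Subtype.ext hx', rfl⟩
  rw [← h]
  exact (Submodule.equivMapOfInjective U.subtype U.injective_subtype _).finrank_eq

theorem ncard_subtype_setOf {ι : Type*} (S : Set ι) (P : S → Prop) (Q : ι → Prop)
    (h : ∀ i : S, P i ↔ Q i) : Nat.card {i : S // P i} = {i | i ∈ S ∧ Q i}.ncard := by
  have h1 : {i | i ∈ S ∧ Q i} = Subtype.val '' {i : S | P i} := by
    ext i
    constructor
    · rintro ⟨hi, hQ⟩
      exact ⟨⟨i, hi⟩, (h ⟨i, hi⟩).mpr hQ, rfl⟩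
    · rintro ⟨j, hj, rfl⟩
      exact ⟨j.2, (h j).mp hj⟩
  rw [h1, Set.ncard_image_of_injective _ Subtype.val_injective, ← Nat.card_coe_set_eq]
  rfl

variable [FiniteDimensional ℝ L]

/-- The dimension of the `ε`-part of a restricted root space. -/
theorem two_mul_finrank_rootSpace_inf_eigenspace {t a : Submodule ℝ L}
    (ht : IsMaximalAbelian ⊤ t) (hat : a ≤ t) {σ : Module.End ℝ L}
    (hlie : ∀ x y, σ ⁅x, y⁆ = ⁅σ x, σ y⁆) (hσ : σ * σ = 1)
    (hform : ∀ x y, B.form (σ x) (σ y) = B.form x y) (hσt : ∀ x ∈ t, σ x ∈ t)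
    (hσa : ∀ x ∈ a, σ x = x) {l : L} (hl : l ∈ a) (hl0 : l ≠ 0) {ε : ℂ} (hε : ε * ε = 1) :
    (rootsOver B t a l).Finite ∧
    2 * Module.finrank ℂ
        (rootSpace B a l ⊓ Module.End.eigenspace (σ.baseChange ℂ) ε : Submodule ℂ (ℂ ⊗[ℝ] L)) =
      2 * {α | α ∈ rootsOver B t a l ∧
        rootSpace B t α ≤ Module.End.eigenspace (σ.baseChange ℂ) ε}.ncard +
      {α | α ∈ rootsOver B t a l ∧ σ α ≠ α}.ncard := by
  classical
  set S := rootsOver B t a l with hS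
  set T := σ.baseChange ℂ with hT
  have hσσ : ∀ x, σ (σ x) = x := fun x => DFunLike.congr_fun hσ x
  have hTT : T * T = 1 := by
    rw [hT, ← LinearMap.baseChange_mul, hσ, LinearMap.baseChange_one]
  have hTroot : ∀ {α X}, X ∈ rootSpace B t α → T X ∈ rootSpace B t (σ α) :=
    fun hX => baseChange_mem_rootSpace B hlie hσ hform hσt hX
  have hne : ∀ α : S, (α : L) ≠ 0 := fun α h => hl0 (by rw [← α.2.2.1, h, map_zero])
  choose e he he0 using fun α : S => Submodule.exists_mem_ne_zero_of_ne_bot α.2.2.2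
  have hspan : ∀ α : S, rootSpace B t α = Submodule.span ℂ {e α} := fun α =>
    rootSpace_eq_span_singleton B ht α.2.1 (hne α) (he0 α) (he α)
  have hli : LinearIndependent ℂ e := by
    let := B.hermCore.toNormedAddCommGroup
    let : InnerProductSpace ℂ (ℂ ⊗[ℝ] L) := InnerProductSpace.ofCore B.hermCore.toCore
    exact linearIndependent_of_ne_zero_of_inner_eq_zero he0 fun α β hαβ =>
      herm_eq_zero_of_mem_rootSpace B α.2.1 β.2.1 (fun h => hαβ (Subtype.ext h)) (he α) (he β)
  have hfin : Finite S := hli.finite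
  have hU : Submodule.span ℂ (Set.range e) = rootSpace B a l := by
    rw [rootSpace_eq_iSup B ht.prop.2 hat hl, Submodule.span_range_eq_iSup]
    exact iSup_congr fun α => (hspan α).symm
  -- σ is an isometry fixing a pointwise, so α and σα have the same pairings with a and lie over the
  -- same l.
  have hpS : ∀ α : S, σ α ∈ S := fun α => by
    refine ⟨hσt _ α.2.1, ?_, fun hbot => ?_⟩
    · rw [proj_eq_iff B hl]
      intro H hH
      rw [← hform, hσσ, hσa H hH]
      exact (proj_eq_iff B hl).mp α.2.2.1 H hH
    · have h := hTroot (he α)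
      rw [hbot, Submodule.mem_bot] at h
      have h1 : T (T (e α)) = e α := DFunLike.congr_fun hTT _
      rw [h, map_zero] at h1
      exact he0 α h1.symm
  let p : S → S := fun α => ⟨σ α, hpS α⟩
  have hc : ∀ α : S, ∃ c : ℂ, c • e (p α) = T (e α) := fun α => by
    rw [← Submodule.mem_span_singleton, ← hspan]
    exact hTroot (he α)
  choose c hc using hc
  have hTU : ∀ X ∈ rootSpace B a l, T X ∈ rootSpace B a l := by
    rw [← hU]
    intro X hX
    have h : Submodule.span ℂ (Set.range e) ≤ (Submodule.span ℂ (Set.range e)).comap T := by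
      rw [Submodule.span_le]
      rintro _ ⟨α, rfl⟩
      change T (e α) ∈ Submodule.span ℂ (Set.range e)
      rw [← hc]
      exact Submodule.smul_mem _ _ (Submodule.subset_span ⟨_, rfl⟩)
    exact h hX
  let b : Module.Basis S ℂ (rootSpace B a l) :=
    (Module.Basis.span hli).map (LinearEquiv.ofEq _ _ hU)
  have hb : ∀ α, (b α : ℂ ⊗[ℝ] L) = e α := fun α => by
    simp [b, Module.Basis.span_apply]
  have : Fintype S := Fintype.ofFinite S
  have key := two_mul_finrank_eigenspace b (T := T.restrict hTU)
    (LinearMap.ext fun X => Subtype.ext (DFunLike.congr_fun hTT (X : ℂ ⊗[ℝ] L))) p c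
    (fun α => Subtype.ext (by
      change T (b α) = c α • (b (p α) : ℂ ⊗[ℝ] L)
      rw [hb, hb, hc])) hε
  rw [finrank_eigenspace_restrict] at key
  refine ⟨hfin, key.trans ?_⟩
  congr 1
  · congr 1
    refine ncard_subtype_setOf S _ _ fun α => ?_
    rw [hspan, Submodule.span_singleton_le_iff_mem, Module.End.mem_eigenspace_iff]
    constructor
    · rintro ⟨h1, h2⟩
      rw [← hc, h1, h2]
    · intro h
      -- If T e = εe, then e lies in the root spaces of both α and σα, which therefore coincide.
      have h1 : p α = α := by
        refine Subtype.ext (eq_of_mem_rootSpace B (p α).2.1 α.2.1 (he0 α) ?_ (he α))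
        have h2 := Submodule.smul_mem _ ε (hTroot (he α))
        rwa [h, smul_smul, hε, one_smul] at h2
      refine ⟨h1, ?_⟩
      rw [← hc, h1] at h
      exact smul_left_injective ℂ (he0 α) h
  · refine ncard_subtype_setOf S _ _ fun α => ?_
    rw [not_iff_not]
    exact Subtype.ext_iff

end Involution

end

end SymmTriad

namespace SymmTriad

noncomputable section

/-! ### Pairs of commuting involutions and the multiplicity formulas. -/

section Triad

variable {L : Type*} [LieRing L] [LieAlgebra ℝ L]

/-- A maximal abelian subalgebra `t` is `θ`-stable if `t ∩ 𝔪` is maximal abelian in `𝔪`. -/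
theorem map_mem_of_isMaximalAbelian {θ : Module.End ℝ L}
    (hlie : ∀ x y, θ ⁅x, y⁆ = ⁅θ x, θ y⁆) (hsq : θ * θ = 1) {t : Submodule ℝ L}
    (ht : IsMaximalAbelian ⊤ t) (htm : IsMaximalAbelian (mSpace θ) (t ⊓ mSpace θ))
    {x : L} (hx : x ∈ t) : θ x ∈ t := by
  have hθθ : ∀ x, θ (θ x) = x := fun x => DFunLike.congr_fun hsq x
  have h1 : x - θ x ∈ mSpace θ := by
    rw [mSpace, Module.End.mem_eigenspace_iff, map_sub, hθθ, neg_one_smul, neg_sub]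
  -- x commutes with t ∩ 𝔪, and so does θx, because θ acts there by -1. Hence x - θx ∈ 𝔪 centralizes
  -- t ∩ 𝔪 and belongs to it.
  have h2 : x - θ x ∈ t ⊓ mSpace θ := by
    refine mem_of_forall_lie_eq_zero htm h1 fun H hH => ?_
    have h3 : ⁅H, x⁆ = 0 := ht.prop.2 H hH.1 x hx
    have h4 : θ H = -H := by
      simpa [mSpace, Module.End.mem_eigenspace_iff] using hH.2
    have h5 : ⁅H, θ x⁆ = 0 := by
      have h6 := hlie H x
      rw [h3, map_zero, h4, neg_lie] at h6
      exact neg_eq_zero.mp h6.symm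
    rw [lie_sub, h3, h5, sub_zero]
  have h7 := t.sub_mem hx h2.1
  rwa [sub_sub_cancel] at h7

/-- The condition θ₁θ₂x = εx amounts to θ₂x = εθ₁x, so θ₂ acts by ε and -ε on the θ₁-even and θ₁-odd
parts of x. With ε = 1 and ε = -1 these are the subspaces defining compact and noncompact roots. -/
theorem eigenspace_mul_eq_sup {θ₁ θ₂ : Module.End ℝ L} (h₁ : θ₁ * θ₁ = 1)
    (hcomm : θ₁ * θ₂ = θ₂ * θ₁) (ε : ℝ) :
    (θ₁ * θ₂).eigenspace ε =
      (kSpace θ₁ ⊓ θ₂.eigenspace ε) ⊔ (mSpace θ₁ ⊓ θ₂.eigenspace (-ε)) := by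
  have h11 : ∀ x, θ₁ (θ₁ x) = x := fun x => DFunLike.congr_fun h₁ x
  have h12 : ∀ x, θ₁ (θ₂ x) = θ₂ (θ₁ x) := fun x => DFunLike.congr_fun hcomm x
  refine le_antisymm (fun x hx => ?_) (sup_le ?_ ?_)
  · have hx1 : θ₁ (θ₂ x) = ε • x := Module.End.mem_eigenspace_iff.mp hx
    have hx2 : θ₂ x = ε • θ₁ x := by rw [← h11 (θ₂ x), hx1, map_smul]
    rw [h12] at hx1
    have hdec : x = (1 / 2 : ℝ) • (x + θ₁ x) + (1 / 2 : ℝ) • (x - θ₁ x) := by module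
    rw [hdec]
    refine Submodule.add_mem_sup (Submodule.smul_mem _ _ ⟨?_, ?_⟩)
      (Submodule.smul_mem _ _ ⟨?_, ?_⟩) <;>
    refine Module.End.mem_eigenspace_iff.mpr ?_
    · rw [map_add, h11]; module
    · rw [map_add, hx1, hx2]; module
    · rw [map_sub, h11]; module
    · rw [map_sub, hx1, hx2]; module
  · rintro x ⟨hx, hx'⟩
    have hx1 : θ₁ x = (1 : ℝ) • x := Module.End.mem_eigenspace_iff.mp hx
    have hx2 : θ₂ x = ε • x := Module.End.mem_eigenspace_iff.mp hx'
    refine Module.End.mem_eigenspace_iff.mpr ?_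
    change θ₁ (θ₂ x) = _
    rw [hx2, map_smul, hx1, one_smul]
  · rintro x ⟨hx, hx'⟩
    have hx1 : θ₁ x = (-1 : ℝ) • x := Module.End.mem_eigenspace_iff.mp hx
    have hx2 : θ₂ x = (-ε) • x := Module.End.mem_eigenspace_iff.mp hx'
    refine Module.End.mem_eigenspace_iff.mpr ?_
    change θ₁ (θ₂ x) = _
    rw [hx2, map_smul, hx1]
    module

variable [FiniteDimensional ℝ L] (B : InvariantInnerProduct L)

/-- For nonzero `l`, the roots over `l` are the roots outside `Δ₀` projecting to `l`. -/
theorem mem_rootsOver_iff {θ₁ θ₂ : Module.End ℝ L} {t : Submodule ℝ L} {l : L}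
    (hl : l ∈ aSpace θ₁ θ₂ t) (hl0 : l ≠ 0) {α : L} :
    α ∈ rootsOver B t (aSpace θ₁ θ₂ t) l ↔
      α ∈ roots B t \ rootsZero B θ₁ θ₂ t ∧ B.proj (aSpace θ₁ θ₂ t) α = l := by
  constructor
  · rintro ⟨h1, h2, h3⟩
    refine ⟨⟨⟨h1, ?_, h3⟩, fun h => ?_⟩, h2⟩
    · rintro rfl
      exact hl0 (by rw [← h2, map_zero])
    · refine hl0 (B.eq_zero_of_form_self ?_)
      rw [← (proj_eq_iff B hl).mp h2 l hl]
      exact h.2 l hl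
  · rintro ⟨⟨h1, -⟩, h2⟩
    exact ⟨h1.1, h2, h1.2.2⟩

theorem proj_mem_roots {θ₁ θ₂ : Module.End ℝ L} {t : Submodule ℝ L} {α : L}
    (hα : α ∈ roots B t \ rootsZero B θ₁ θ₂ t) :
    B.proj (aSpace θ₁ θ₂ t) α ∈ roots B (aSpace θ₁ θ₂ t) := by
  refine ⟨proj_mem B _ α, fun h0 => hα.2 ⟨hα.1, fun H hH => ?_⟩, fun hbot => hα.1.2.2 ?_⟩
  · rw [← form_proj B _ α hH, h0]
    simp
  · rw [eq_bot_iff, ← hbot]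
    exact rootSpace_le_rootSpace_proj B inf_le_left α

/-- The sets of restricted roots with nonzero multiplicity, from the multiplicities. -/
theorem setOf_ne_bot_eq_image_union {θ₁ θ₂ : Module.End ℝ L} {t : Submodule ℝ L}
    {N C : Set L} (hN : N ⊆ roots B t \ rootsZero B θ₁ θ₂ t)
    (hC : C ⊆ roots B t \ rootsZero B θ₁ θ₂ t) (V : L → Submodule ℂ (ℂ ⊗[ℝ] L))
    (hfin : ∀ l ∈ roots B (aSpace θ₁ θ₂ t), (rootsOver B t (aSpace θ₁ θ₂ t) l).Finite)
    (hV : ∀ l ∈ roots B (aSpace θ₁ θ₂ t), 2 * Module.finrank ℂ (V l) =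
      2 * {α ∈ N | B.proj (aSpace θ₁ θ₂ t) α = l}.ncard +
        {α ∈ C | B.proj (aSpace θ₁ θ₂ t) α = l}.ncard) :
    {l | l ∈ roots B (aSpace θ₁ θ₂ t) ∧ V l ≠ ⊥} =
      B.proj (aSpace θ₁ θ₂ t) '' N ∪ B.proj (aSpace θ₁ θ₂ t) '' C := by
  ext l
  constructor
  · rintro ⟨hl, hne⟩
    have h1 : Module.finrank ℂ (V l) ≠ 0 := fun h => hne (Submodule.finrank_eq_zero.mp h)
    have h2 := hV l hl
    by_contra hnot
    rw [Set.mem_union, not_or] at hnot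
    have h3 : {α ∈ N | B.proj (aSpace θ₁ θ₂ t) α = l} = ∅ :=
      Set.eq_empty_iff_forall_notMem.mpr fun α hα => hnot.1 ⟨α, hα⟩
    have h4 : {α ∈ C | B.proj (aSpace θ₁ θ₂ t) α = l} = ∅ :=
      Set.eq_empty_iff_forall_notMem.mpr fun α hα => hnot.2 ⟨α, hα⟩
    rw [h3, h4, Set.ncard_empty] at h2
    omega
  · have hpos : ∀ M : Set L, M ⊆ roots B t \ rootsZero B θ₁ θ₂ t → ∀ α ∈ M,
        0 < {β ∈ M | B.proj (aSpace θ₁ θ₂ t) β = B.proj (aSpace θ₁ θ₂ t) α}.ncard := by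
      intro M hM α hα
      have hl := proj_mem_roots B (hM hα)
      -- Finiteness is essential here, since `Set.ncard` is 0 on infinite sets.
      refine (Set.ncard_pos ((hfin _ hl).subset fun β hβ => ?_)).mpr ⟨α, hα, rfl⟩
      exact (mem_rootsOver_iff B hl.1 hl.2.1).mpr ⟨hM hβ.1, hβ.2⟩
    rintro (⟨α, hα, rfl⟩ | ⟨α, hα, rfl⟩)
    · have hl := proj_mem_roots B (hN hα)
      refine ⟨hl, fun hbot => ?_⟩
      have h1 := hV _ hl
      rw [hbot, finrank_bot] at h1
      have := hpos N hN α hα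
      omega
    · have hl := proj_mem_roots B (hC hα)
      refine ⟨hl, fun hbot => ?_⟩
      have h1 := hV _ hl
      rw [hbot, finrank_bot] at h1
      have := hpos C hC α hα
      omega

/-- The restricted roots and multiplicities of a pair of commuting involutions of a simple Lie
algebra with an invariant inner product. -/
theorem restrictedRoots_and_multiplicities (hsimple : LieAlgebra.IsSimple ℝ L)
    {θ₁ θ₂ : Module.End ℝ L} (hlie₁ : ∀ x y, θ₁ ⁅x, y⁆ = ⁅θ₁ x, θ₁ y⁆)
    (hlie₂ : ∀ x y, θ₂ ⁅x, y⁆ = ⁅θ₂ x, θ₂ y⁆) (h₁ : θ₁ * θ₁ = 1) (h₂ : θ₂ * θ₂ = 1)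
    (hcomm : θ₁ * θ₂ = θ₂ * θ₁) {t a : Submodule ℝ L} (ht : IsAdaptedTorus θ₁ θ₂ t)
    (ha : a = aSpace θ₁ θ₂ t) :
    sigmaSet B θ₁ θ₂ a = B.proj a '' rootsCpt B θ₁ θ₂ t ∪ B.proj a '' rootsCpx B θ₁ θ₂ t ∧
    wSet B θ₁ θ₂ a = B.proj a '' rootsNoncpt B θ₁ θ₂ t ∪ B.proj a '' rootsCpx B θ₁ θ₂ t ∧
    ∀ l ∈ roots B a,
      (mMult B θ₁ θ₂ a l : ℚ) = ({α ∈ rootsCpt B θ₁ θ₂ t | B.proj a α = l}.ncard : ℚ) +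
        1 / 2 * ({β ∈ rootsCpx B θ₁ θ₂ t | B.proj a β = l}.ncard : ℚ) ∧
      (nMult B θ₁ θ₂ a l : ℚ) = ({α ∈ rootsNoncpt B θ₁ θ₂ t | B.proj a α = l}.ncard : ℚ) +
        1 / 2 * ({β ∈ rootsCpx B θ₁ θ₂ t | B.proj a β = l}.ncard : ℚ) := by
  subst ha
  set a := aSpace θ₁ θ₂ t with ha
  set σ := θ₁ * θ₂ with hσ
  have hat : a ≤ t := inf_le_left
  have hσapp : ∀ x, σ x = θ₁ (θ₂ x) := fun x => rfl
  have hlie : ∀ x y, σ ⁅x, y⁆ = ⁅σ x, σ y⁆ := fun x y => by simp only [hσapp, hlie₁, hlie₂]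
  have hσσ : σ * σ = 1 := by
    rw [hσ, mul_assoc, ← mul_assoc θ₂, ← hcomm, mul_assoc, h₂, mul_one, h₁]
  have hσt : ∀ x ∈ t, σ x ∈ t := fun x hx =>
    map_mem_of_isMaximalAbelian hlie₁ h₁ ht.maximal ht.maximal_left
      (map_mem_of_isMaximalAbelian hlie₂ h₂ ht.maximal ht.maximal_right hx)
  have hσa : ∀ x ∈ a, σ x = x := fun x hx => by
    have hx1 : θ₁ x = (-1 : ℝ) • x := Module.End.mem_eigenspace_iff.mp hx.2.1
    have hx2 : θ₂ x = (-1 : ℝ) • x := Module.End.mem_eigenspace_iff.mp hx.2.2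
    rw [hσapp, hx2, map_smul, hx1, smul_smul]
    simp
  have hcpt : ((kSpace θ₁ ⊓ kSpace θ₂) ⊔ (mSpace θ₁ ⊓ mSpace θ₂)).baseChange ℂ =
      Module.End.eigenspace (σ.baseChange ℂ) 1 := by
    rw [← Complex.ofReal_one, eigenspace_baseChange B, eigenspace_mul_eq_sup h₁ hcomm]
    rfl
  have hnoncpt : ((kSpace θ₁ ⊓ mSpace θ₂) ⊔ (mSpace θ₁ ⊓ kSpace θ₂)).baseChange ℂ =
      Module.End.eigenspace (σ.baseChange ℂ) (-1) := by
    rw [← Complex.ofReal_one, ← Complex.ofReal_neg, eigenspace_baseChange B,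
      eigenspace_mul_eq_sup h₁ hcomm, neg_neg]
    rfl
  have hform := form_map_map B hsimple hlie hσσ
  have count : ∀ l ∈ roots B a, ∀ ε : ℂ, ε * ε = 1 → _ := fun l hl ε hε =>
    two_mul_finrank_rootSpace_inf_eigenspace B ht.maximal hat hlie hσσ hform hσt hσa
      hl.1 hl.2.1 hε
  have hfin : ∀ l ∈ roots B a, (rootsOver B t a l).Finite := fun l hl =>
    (count l hl 1 (by simp)).1
  -- Over a nonzero l the condition of lying outside Δ₀ is automatic, so the counts over l become
  -- counts of roots of each type.
  have hset : ∀ l ∈ roots B a, ∀ P : L → Prop,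
      {α | α ∈ rootsOver B t a l ∧ P α} =
        {α ∈ {α | α ∈ roots B t \ rootsZero B θ₁ θ₂ t ∧ P α} | B.proj a α = l} := by
    intro l hl P
    ext α
    have h := mem_rootsOver_iff B hl.1 hl.2.1 (α := α)
    exact ⟨fun hα => ⟨⟨(h.mp hα.1).1, hα.2⟩, (h.mp hα.1).2⟩,
      fun hα => ⟨h.mpr ⟨hα.1.1, hα.2⟩, hα.1.2⟩⟩
  have hsigma : ∀ α, sigmaMap θ₁ (sigmaMap θ₂ α) = σ α := fun α => by
    simp [sigmaMap, hσapp]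
  have hm : ∀ l ∈ roots B a, 2 * Module.finrank ℂ (signedRootSpace B θ₁ θ₂ a l 1) =
      2 * {α ∈ rootsCpt B θ₁ θ₂ t | B.proj a α = l}.ncard +
        {β ∈ rootsCpx B θ₁ θ₂ t | B.proj a β = l}.ncard := fun l hl => by
    have h := (count l hl 1 (by simp)).2
    rw [hset l hl, hset l hl] at h
    simp only [rootsCpt, rootsCpx, hsigma, signedRootSpace]
    rwa [hcpt]
  have hn : ∀ l ∈ roots B a, 2 * Module.finrank ℂ (signedRootSpace B θ₁ θ₂ a l (-1)) =
      2 * {α ∈ rootsNoncpt B θ₁ θ₂ t | B.proj a α = l}.ncard +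
        {β ∈ rootsCpx B θ₁ θ₂ t | B.proj a β = l}.ncard := fun l hl => by
    have h := (count l hl (-1) (by simp)).2
    rw [hset l hl, hset l hl] at h
    simp only [rootsNoncpt, rootsCpx, hsigma, signedRootSpace]
    rwa [hnoncpt]
  refine ⟨setOf_ne_bot_eq_image_union B (fun _ h => h.1) (fun _ h => h.1) _ hfin hm,
    setOf_ne_bot_eq_image_union B (fun _ h => h.1) (fun _ h => h.1) _ hfin hn,
    fun l hl => ⟨?_, ?_⟩⟩
  · have h := congrArg (Nat.cast (R := ℚ)) (hm l hl)
    push_cast at h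
    rw [mMult]
    linarith
  · have h := congrArg (Nat.cast (R := ℚ)) (hn l hl)
    push_cast at h
    rw [nMult]
    linarith

end Triad

end

end SymmTriad

/-! ### Passage from the group to its Lie algebra. -/

theorem mainTheorem8
    {E : Type*} [NormedAddCommGroup E] [NormedSpace ℝ E] [FiniteDimensional ℝ E]
    {G : Type*} [TopologicalSpace G] [ChartedSpace E G] [Group G] [LieGroup 𝓘(ℝ, E) ∞ G]
    [CompactSpace G] [ConnectedSpace G]
    (hsimple : LieAlgebra.IsSimple ℝ (GroupLieAlgebra 𝓘(ℝ, E) G))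
    (Θ₁ Θ₂ : G ≃* G) (hΘ₁ : SymmTriad.IsInvolution E Θ₁) (hΘ₂ : SymmTriad.IsInvolution E Θ₂)
    (hcomm : ∀ g, Θ₁ (Θ₂ g) = Θ₂ (Θ₁ g))
    (B : SymmTriad.InvariantInnerProduct (GroupLieAlgebra 𝓘(ℝ, E) G))
    (θ₁ θ₂ : Module.End ℝ (GroupLieAlgebra 𝓘(ℝ, E) G))
    (hθ₁ : θ₁ = SymmTriad.differential E Θ₁) (hθ₂ : θ₂ = SymmTriad.differential E Θ₂)
    (t a : Submodule ℝ (GroupLieAlgebra 𝓘(ℝ, E) G))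
    (ht : SymmTriad.IsAdaptedTorus θ₁ θ₂ t) (ha : a = SymmTriad.aSpace θ₁ θ₂ t) :
    SymmTriad.sigmaSet B θ₁ θ₂ a =
        B.proj a '' SymmTriad.rootsCpt B θ₁ θ₂ t ∪ B.proj a '' SymmTriad.rootsCpx B θ₁ θ₂ t ∧
      SymmTriad.wSet B θ₁ θ₂ a =
        B.proj a '' SymmTriad.rootsNoncpt B θ₁ θ₂ t ∪ B.proj a '' SymmTriad.rootsCpx B θ₁ θ₂ t ∧
      ∀ l ∈ SymmTriad.roots B a,
        (SymmTriad.mMult B θ₁ θ₂ a l : ℚ) =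
            ({α ∈ SymmTriad.rootsCpt B θ₁ θ₂ t | B.proj a α = l}.ncard : ℚ) +
              1 / 2 * ({β ∈ SymmTriad.rootsCpx B θ₁ θ₂ t | B.proj a β = l}.ncard : ℚ) ∧
        (SymmTriad.nMult B θ₁ θ₂ a l : ℚ) =
            ({α ∈ SymmTriad.rootsNoncpt B θ₁ θ₂ t | B.proj a α = l}.ncard : ℚ) +
              1 / 2 * ({β ∈ SymmTriad.rootsCpx B θ₁ θ₂ t | B.proj a β = l}.ncard : ℚ) := by
  subst hθ₁ hθ₂
  exact SymmTriad.restrictedRoots_and_multiplicities B hsimple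
    (SymmTriad.differential_lie hΘ₁) (SymmTriad.differential_lie hΘ₂)
    (SymmTriad.differential_mul_self hΘ₁) (SymmTriad.differential_mul_self hΘ₂)
    (SymmTriad.differential_commute hΘ₁ hΘ₂ hcomm) ht ha
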